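/- Let $n\ge 1$ and let $f:\mathbb R^n\to\mathbb R$ be continuous. Its spherical mean transform is $$(\mathcal Rf)(x,t)=\int_{|y-x|=t}f(y)\,dS_y,\qquad x\in\mathbb R^n,\ t\ge 0,$$ where $dS_y$ is the standard (unnormalized) surface measure on the sphere with center $x$ and radius $t$ (the counting measure on $\{x-t,x+t\}$ if $n=1$ and $t>0$). A set $S\subset\mathbb R^n\times\mathbb R$ is called a space-like surface if it is connected and nonempty, and there is a continuously differentiable $F:\mathbb R^{n+1}\to\mathbb R$ with $S=\{F=0\}$ such that at every point of $S$ the normal $N=\nabla F$ satisfies $N\ne 0$ and $N_{n+1}^2\ge\sum_{i=1}^n N_i^2$. A point $(p,p_{n+1})$ is called above $S$ if the segment $[(p,0),(p,p_{n+1})]$ intersects $S$ and the ray $\{(p,s):s\ge p_{n+1}\}$ does not. Let $S$ be a space-like surface contained in $\mathbb R^n\times(0,\infty)$, and assume that at every point of $S$ the function $\mathcal Rf$ vanishes, is differentiable, and has all its first-order derivatives equal to zero. Then $(\mathcal Rf)(p,p_{n+1})=0$ for every point $(p,p_{n+1})\in\mathbb R^n\times[0,\infty)$ that is above $S$. -/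

import Mathlib

open MeasureTheory

noncomputable section

/-- The surface measure of the sphere `{y : |y - x| = t}` in `ℝⁿ` (for `t ≥ 0`), as a measure on
`ℝⁿ`: the image of the surface measure of the unit sphere (Mathlib's `toSphere`, the angular part
of Lebesgue measure in polar coordinates) under `ω ↦ x + t ω`, scaled by `t ^ (n - 1)`. For `n = 1`
and `t > 0` it is the counting measure on `{x - t, x + t}`. -/
def sphereSurfaceMeasure {n : ℕ} (x : EuclideanSpace ℝ (Fin n)) (t : ℝ) :
    Measure (EuclideanSpace ℝ (Fin n)) :=
  ENNReal.ofReal (t ^ (n - 1)) •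
    ((volume : Measure (EuclideanSpace ℝ (Fin n))).toSphere).map
      (fun ω : Metric.sphere (0 : EuclideanSpace ℝ (Fin n)) 1 =>
        x + t • (ω : EuclideanSpace ℝ (Fin n)))

/-- The spherical mean transform `(Rf)(x, t) = ∫_{|y - x| = t} f(y) dS_y`. -/
def sphericalMeanTransform {n : ℕ} (f : EuclideanSpace ℝ (Fin n) → ℝ)
    (z : EuclideanSpace ℝ (Fin n) × ℝ) : ℝ :=
  ∫ y, f y ∂(sphereSurfaceMeasure z.1 z.2)

/-- A smooth, connected, space-like hypersurface of `ℝⁿ × ℝ`: a connected set which is the zero set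
of a continuously differentiable function `F` on the whole of `ℝⁿ × ℝ`, whose gradient does not
vanish on the zero set, and whose gradient (a normal of the hypersurface) `N` satisfies
`N₁² + ⋯ + Nₙ² ≤ Nₙ₊₁²` at each point of the hypersurface. -/
def IsSpaceLike {n : ℕ} (S : Set (EuclideanSpace ℝ (Fin n) × ℝ)) : Prop :=
  IsConnected S ∧
    ∃ F : EuclideanSpace ℝ (Fin n) × ℝ → ℝ,
      ContDiff ℝ 1 F ∧
      S = {z | F z = 0} ∧
      (∀ z ∈ S, fderiv ℝ F z ≠ 0) ∧
      ∀ z ∈ S,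
        ∑ i : Fin n, (fderiv ℝ F z (EuclideanSpace.single i (1 : ℝ), (0 : ℝ))) ^ 2
          ≤ (fderiv ℝ F z (0, 1)) ^ 2

/-- The point `(p, T)` is above `S` if the segment from `(p, 0)` to `(p, T)` meets `S` and the
vertical ray from `(p, T)` upwards (including `(p, T)`) does not. -/
def IsAbove {n : ℕ} (S : Set (EuclideanSpace ℝ (Fin n) × ℝ))
    (p : EuclideanSpace ℝ (Fin n)) (T : ℝ) : Prop :=
  (∃ s ∈ Set.Icc (0 : ℝ) T, (p, s) ∈ S) ∧ ∀ s ∈ Set.Ici T, (p, s) ∉ S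

end

/-! Write u = Rf. Dividing by t^(n-1) gives the spherical averages of f (up to a constant), which
formally solve the Euler–Poisson–Darboux equation q_tt + (n-1)/t q_t = Δq. This is a wave equation
of unit speed with a friction term of favourable sign. Vanishing Cauchy data on a space-like surface
should force the solution to vanish above it. As f is only continuous, everything is done weakly.

Weak equation. The operator `epd` is symmetric for the weight t^(n-1), so the claim is ∫ u · epd v =
0 for test functions v. In polar coordinates the left side becomes ∫ f(y) ∫ epd v(x, |x-y|) dx dy.
The inner integrand is a divergence in x, so it integrates to zero
(`IsTest.integral_epd_cone_eq_zero`, `integral_sphMean_mul_epd`).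

Graph. The time derivative of F cannot vanish on S, and by connectedness it has one sign there.
Hence S is the graph of a Lipschitz function φ over all of ℝⁿ (`IsSpaceLike.exists_graph`).

Gluing. Replacing u by 0 below the graph must again give a weak solution. The hypothesis says u =
o(distance) at each point of S, but with no uniformity, so a cutoff along the whole graph cannot be
estimated directly. The proof of `epigraphPairing_eq_zero` is a Goursat-type subdivision. If the
pairing over the epigraph were nonzero, a refinable partition of unity would yield spline pieces at
scales 2^(-k), shrinking to one point x₀, with pairings at least A · 2^(-kn). Near (x₀, φ x₀),
however, u is o(2^(-k)), `epd` of the localized test function is O(4^k), and the volume is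
O(2^(-k(n+1))). The pairing is thus o(2^(-kn)), a contradiction.

Uniqueness. The glued function q, divided by t^(n-1), vanishes below a positive graph. Mollifying in
x only makes it smooth in x, and the weak equation then makes it differentiable in t
(`hasDerivAt_moll_time_of_weak`). An energy identity, weighted by the square of a function whose
level sets are space-like, forces the time derivative to vanish (`moll_timePrimitive_lap_eq_zero`).
So every mollification is zero, and q = 0 (`eq_zero_of_weak`). -/

noncomputable section

/-! ### Directional derivatives and integration by parts. -/

section Calculus

open Set Filter Topology

/-- The derivative of a real function in the direction `e`. -/
def dirD {V : Type*} [NormedAddCommGroup V] [NormedSpace ℝ V] (e : V) (v : V → ℝ) : V → ℝ :=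
  fun z => fderiv ℝ v z e

variable {V : Type*} [NormedAddCommGroup V] [NormedSpace ℝ V]

/-- Integration by parts against the constant 1. Only a derivative along the single direction `e` is
required; the fields in the energy estimate are differentiated one direction at a time. -/
theorem integral_eq_zero_of_hasLineDerivAt [FiniteDimensional ℝ V] [MeasurableSpace V]
    [BorelSpace V] {μ : Measure V} [μ.IsAddHaarMeasure] {g g' : V → ℝ} {e : V}
    (hg : Continuous g) (hs : HasCompactSupport g) (hg' : Continuous g')
    (h : ∀ x, HasLineDerivAt ℝ g (g' x) x e) : ∫ x, g' x ∂μ = 0 := by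
  have hs' : HasCompactSupport g' := by
    refine hs.mono' fun x hx => ?_
    by_contra hx'
    apply hx
    have h0 : g =ᶠ[𝓝 x] fun _ => 0 := notMem_tsupport_iff_eventuallyEq.1 hx'
    have h1 : HasLineDerivAt ℝ g 0 x e :=
      HasLineDerivAt.congr_of_eventuallyEq
        (by simpa using (hasFDerivAt_const (0 : ℝ) x).hasLineDerivAt e) h0
    exact (h x).unique h1
  have key := integral_bilinear_hasLineDerivAt_right_eq_neg_left_of_integrable (μ := μ)
    (f := fun _ : V => (1 : ℝ)) (f' := fun _ => 0) (g := g) (g' := g') (v := e)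
    (B := ContinuousLinearMap.mul ℝ ℝ)
    (by simp) (by simpa using hg'.integrable_of_hasCompactSupport hs')
    (by simpa using hg.integrable_of_hasCompactSupport hs)
    (fun x _ => by simpa using (hasFDerivAt_const (1 : ℝ) x).hasLineDerivAt e)
    (fun x _ => h x)
  simpa using key

theorem dirD_congr {e : V} {v w : V → ℝ} {z : V} (h : v =ᶠ[𝓝 z] w) :
    dirD e v =ᶠ[𝓝 z] dirD e w := by
  filter_upwards [h.eventually_nhds] with y hy
  simp only [dirD, Filter.EventuallyEq.fderiv_eq hy]

theorem dirD_eq_zero_of_notMem_tsupport {e : V} {v : V → ℝ} {z : V} (h : z ∉ tsupport v) :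
    dirD e v =ᶠ[𝓝 z] 0 := by
  have h0 : v =ᶠ[𝓝 z] 0 := notMem_tsupport_iff_eventuallyEq.1 h
  refine (dirD_congr h0).trans (Eventually.of_forall fun y => ?_)
  simp [dirD]

theorem tsupport_dirD_subset (e : V) (v : V → ℝ) : tsupport (dirD e v) ⊆ tsupport v := by
  intro z hz
  by_contra h
  exact (notMem_tsupport_iff_eventuallyEq.2 (dirD_eq_zero_of_notMem_tsupport (e := e) h)) hz

theorem HasCompactSupport.dirD {e : V} {v : V → ℝ} (h : HasCompactSupport v) :
    HasCompactSupport (dirD e v) :=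
  h.mono' ((subset_tsupport _).trans (tsupport_dirD_subset e v))

theorem ContDiff.dirD {e : V} {v : V → ℝ} {m k : WithTop ℕ∞} (h : ContDiff ℝ k v)
    (hmk : m + 1 ≤ k) : ContDiff ℝ m (dirD e v) :=
  (h.fderiv_right hmk).clm_apply contDiff_const

theorem dirD_mul {e : V} {v w : V → ℝ} {z : V} (hv : DifferentiableAt ℝ v z)
    (hw : DifferentiableAt ℝ w z) :
    dirD e (fun y => v y * w y) z = dirD e v z * w z + v z * dirD e w z := by
  simp only [dirD]
  rw [fderiv_fun_mul hv hw]
  simp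
  ring

theorem dirD_add {e : V} {v w : V → ℝ} {z : V} (hv : DifferentiableAt ℝ v z)
    (hw : DifferentiableAt ℝ w z) :
    dirD e (fun y => v y + w y) z = dirD e v z + dirD e w z := by
  simp only [dirD]
  rw [fderiv_fun_add hv hw]
  simp

theorem dirD_const_mul {e : V} {v : V → ℝ} {z : V} (c : ℝ) (hv : DifferentiableAt ℝ v z) :
    dirD e (fun y => c * v y) z = c * dirD e v z := by
  simp only [dirD]
  rw [fderiv_const_mul hv]
  simp

theorem dirD_scale {e : V} {v : V → ℝ} {z : V} (a : ℝ) (c : V)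
    (hv : Differentiable ℝ v) :
    dirD e (fun y => v (a • y + c)) z = a * dirD e v (a • z + c) := by
  simp only [dirD]
  have h1 : HasFDerivAt (fun y : V => a • y + c) (a • ContinuousLinearMap.id ℝ V) z :=
    ((hasFDerivAt_id z).const_smul a).add_const c
  have := (hv (a • z + c)).hasFDerivAt.comp z h1
  rw [show (fun y => v (a • y + c)) = v ∘ (fun y => a • y + c) from rfl, this.fderiv]
  simp

theorem dirD_dirD_mul {e : V} {v w : V → ℝ} {z : V} (hv : ContDiff ℝ 2 v)
    (hw : ContDiff ℝ 2 w) :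
    dirD e (dirD e (fun y => v y * w y)) z =
      dirD e (dirD e v) z * w z + 2 * (dirD e v z * dirD e w z) + v z * dirD e (dirD e w) z := by
  have dv := hv.differentiable (by norm_num)
  have dw := hw.differentiable (by norm_num)
  have dv' := (ContDiff.dirD (e := e) (m := 1) hv (by norm_num)).differentiable (by norm_num)
  have dw' := (ContDiff.dirD (e := e) (m := 1) hw (by norm_num)).differentiable (by norm_num)
  have h1 : dirD e (fun y => v y * w y) = fun z => dirD e v z * w z + v z * dirD e w z :=
    funext fun z => dirD_mul (dv z) (dw z)
  rw [h1, dirD_add (by fun_prop) (by fun_prop), dirD_mul (dv' z) (dw z), dirD_mul (dv z) (dw' z)]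
  ring

theorem dirD_dirD_scale {e : V} {v : V → ℝ} {z : V} (a : ℝ) (c : V)
    (hv : ContDiff ℝ 2 v) :
    dirD e (dirD e (fun y => v (a • y + c))) z = a ^ 2 * dirD e (dirD e v) (a • z + c) := by
  have dv := hv.differentiable (by norm_num)
  have dv' := (ContDiff.dirD (e := e) (m := 1) hv (by norm_num)).differentiable (by norm_num)
  have h1 : dirD e (fun y => v (a • y + c)) = fun z => a * dirD e v (a • z + c) :=
    funext fun z => dirD_scale a c dv
  rw [h1, dirD_const_mul, dirD_scale a c dv']
  · ring
  · exact (dv' _).comp z (by fun_prop)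

theorem exists_bound_of_hasCompactSupport {X : Type*} [TopologicalSpace X] [Nonempty X] {g : X → ℝ} (hg : Continuous g)
    (hs : HasCompactSupport g) : ∃ C, 0 ≤ C ∧ ∀ z, |g z| ≤ C := by
  obtain ⟨C, hC⟩ := hs.exists_bound_of_continuous hg
  exact ⟨C, (norm_nonneg _).trans (hC (Classical.arbitrary X)), hC⟩

end Calculus

/-! ### The Euler–Poisson–Darboux operator on test functions. -/

section EPD

open Set Filter Topology

variable {n : ℕ}

/-- The Euler–Poisson–Darboux operator (adjoint form)
`v ↦ v_tt + (n - 1) / t * v_t - Δ v` on `ℝⁿ × ℝ`. -/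
def epd (v : EuclideanSpace ℝ (Fin n) × ℝ → ℝ) (z : EuclideanSpace ℝ (Fin n) × ℝ) : ℝ :=
  dirD (0, 1) (dirD (0, 1) v) z + (n - 1) * (dirD (0, 1) v z / z.2)
    - ∑ i : Fin n, dirD (EuclideanSpace.single i (1 : ℝ), (0 : ℝ))
        (dirD (EuclideanSpace.single i (1 : ℝ), (0 : ℝ)) v) z

/-- Compactly supported `C²` functions on the open half-space `t > 0`. -/
structure IsTest (v : EuclideanSpace ℝ (Fin n) × ℝ → ℝ) : Prop where
  contDiff : ContDiff ℝ 2 v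
  compact : HasCompactSupport v
  pos : ∀ z ∈ tsupport v, 0 < z.2

theorem continuous_div_time {g : EuclideanSpace ℝ (Fin n) × ℝ → ℝ} (hg : Continuous g)
    (hpos : ∀ z ∈ tsupport g, 0 < z.2) : Continuous fun z => g z / z.2 := by
  rw [continuous_iff_continuousAt]
  intro z
  by_cases hz : z ∈ tsupport g
  · exact hg.continuousAt.div continuous_snd.continuousAt (hpos z hz).ne'
  · have h0 : g =ᶠ[𝓝 z] 0 := notMem_tsupport_iff_eventuallyEq.1 hz
    have : (fun z => g z / z.2) =ᶠ[𝓝 z] fun _ => 0 := by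
      filter_upwards [h0] with y hy
      simp [hy]
    exact continuousAt_const.congr this.symm

theorem exists_bound_div_time {g : EuclideanSpace ℝ (Fin n) × ℝ → ℝ} (hg : Continuous g)
    (hs : HasCompactSupport g) (hpos : ∀ z ∈ tsupport g, 0 < z.2) :
    ∃ C, 0 ≤ C ∧ ∀ z, |g z / z.2| ≤ C := by
  refine exists_bound_of_hasCompactSupport (continuous_div_time hg hpos) ?_
  refine hs.mono fun z hz => ?_
  contrapose! hz
  simp [Function.notMem_support.1 hz]

theorem epd_congr {v w : EuclideanSpace ℝ (Fin n) × ℝ → ℝ} {z : EuclideanSpace ℝ (Fin n) × ℝ}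
    (h : v =ᶠ[𝓝 z] w) : epd v z = epd w z := by
  simp only [epd]
  rw [(dirD_congr h).eq_of_nhds, (dirD_congr (dirD_congr h)).eq_of_nhds]
  congr 1
  exact Finset.sum_congr rfl fun i _ => (dirD_congr (dirD_congr h)).eq_of_nhds

theorem epd_zero (z : EuclideanSpace ℝ (Fin n) × ℝ) :
    epd (fun _ : EuclideanSpace ℝ (Fin n) × ℝ => (0 : ℝ)) z = 0 := by
  have h : ∀ e : EuclideanSpace ℝ (Fin n) × ℝ,
      dirD e (fun _ : EuclideanSpace ℝ (Fin n) × ℝ => (0 : ℝ)) = fun _ => 0 := by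
    intro e; funext z; simp [dirD]
  simp [epd, h]

theorem epd_eq_zero_of_notMem_tsupport {v : EuclideanSpace ℝ (Fin n) × ℝ → ℝ}
    {z : EuclideanSpace ℝ (Fin n) × ℝ} (h : z ∉ tsupport v) : epd v z = 0 := by
  rw [epd_congr (notMem_tsupport_iff_eventuallyEq.1 h)]
  exact epd_zero z

theorem tsupport_epd_subset (v : EuclideanSpace ℝ (Fin n) × ℝ → ℝ) :
    tsupport (epd v) ⊆ tsupport v := by
  refine closure_minimal (fun z hz => ?_) (isClosed_tsupport v)
  by_contra h
  exact hz (epd_eq_zero_of_notMem_tsupport h)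

namespace IsTest

variable {v w : EuclideanSpace ℝ (Fin n) × ℝ → ℝ}

theorem hasCompactSupport_epd (hv : IsTest v) : HasCompactSupport (epd v) :=
  hv.compact.mono' ((subset_tsupport _).trans (tsupport_epd_subset v))

theorem pos_dirD (hv : IsTest v) (e : EuclideanSpace ℝ (Fin n) × ℝ) :
    ∀ z ∈ tsupport (dirD e v), 0 < z.2 :=
  fun z hz => hv.pos z (tsupport_dirD_subset _ _ hz)

theorem contDiff_dirD (hv : IsTest v) (e : EuclideanSpace ℝ (Fin n) × ℝ) :
    ContDiff ℝ 1 (dirD e v) := hv.contDiff.dirD (by norm_num)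

theorem continuous_dirD_dirD (hv : IsTest v) (e e' : EuclideanSpace ℝ (Fin n) × ℝ) :
    Continuous (dirD e (dirD e' v)) :=
  ((hv.contDiff_dirD e').dirD (m := 0) (by norm_num)).continuous

theorem continuous_epd (hv : IsTest v) : Continuous (epd v) := by
  refine ((hv.continuous_dirD_dirD _ _).add (continuous_const.mul ?_)).sub
    (continuous_finsetSum _ fun i _ => hv.continuous_dirD_dirD _ _)
  exact continuous_div_time (hv.contDiff_dirD _).continuous (hv.pos_dirD _)

theorem mul_right (hv : IsTest v) (hw : ContDiff ℝ 2 w) : IsTest (fun z => v z * w z) where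
  contDiff := hv.contDiff.mul hw
  compact := hv.compact.mul_right
  pos := fun z hz => hv.pos z (tsupport_mul_subset_left hz)

theorem const_mul (hv : IsTest v) (c : ℝ) : IsTest (fun z => c * v z) where
  contDiff := contDiff_const.mul hv.contDiff
  compact := hv.compact.mul_left
  pos := fun z hz => hv.pos z (tsupport_mul_subset_right hz)

theorem add (hv : IsTest v) (hw : IsTest w) : IsTest (fun z => v z + w z) where
  contDiff := hv.contDiff.add hw.contDiff
  compact := hv.compact.add hw.compact
  pos := fun z hz => (tsupport_add v w hz).elim (hv.pos z) (hw.pos z)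

theorem zero : IsTest (fun _ : EuclideanSpace ℝ (Fin n) × ℝ => (0 : ℝ)) where
  contDiff := contDiff_const
  compact := HasCompactSupport.zero
  pos := fun z hz => by simp [tsupport, Function.support] at hz

theorem sum {ι : Type*} (s : Finset ι) {v : ι → EuclideanSpace ℝ (Fin n) × ℝ → ℝ}
    (hv : ∀ i ∈ s, IsTest (v i)) : IsTest (fun z => ∑ i ∈ s, v i z) := by
  classical
  induction s using Finset.induction_on with
  | empty => simpa using IsTest.zero
  | insert a s ha ih =>
    simp only [Finset.sum_insert ha]
    exact (hv a (by simp)).add (ih fun i hi => hv i (by simp [hi]))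

theorem epd_add (hv : IsTest v) (hw : IsTest w) (z : EuclideanSpace ℝ (Fin n) × ℝ) :
    epd (fun z => v z + w z) z = epd v z + epd w z := by
  have h1 : ∀ e, dirD e (fun z => v z + w z) = fun z => dirD e v z + dirD e w z := fun e =>
    funext fun z => dirD_add (hv.contDiff.differentiable (by norm_num) z)
      (hw.contDiff.differentiable (by norm_num) z)
  have h2 : ∀ e z, dirD e (fun z => dirD e v z + dirD e w z) z
      = dirD e (dirD e v) z + dirD e (dirD e w) z := fun e z =>
    dirD_add ((hv.contDiff_dirD e).differentiable (by norm_num) z)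
      ((hw.contDiff_dirD e).differentiable (by norm_num) z)
  simp only [epd, h1, h2, Finset.sum_add_distrib]
  ring

theorem epd_const_mul (hv : IsTest v) (c : ℝ) (z : EuclideanSpace ℝ (Fin n) × ℝ) :
    epd (fun z => c * v z) z = c * epd v z := by
  have h1 : ∀ e, dirD e (fun z => c * v z) = fun z => c * dirD e v z := fun e =>
    funext fun z => dirD_const_mul c (hv.contDiff.differentiable (by norm_num) z)
  have h2 : ∀ e z, dirD e (fun z => c * dirD e v z) z
      = c * dirD e (dirD e v) z := fun e z =>
    dirD_const_mul c ((hv.contDiff_dirD e).differentiable (by norm_num) z)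
  simp only [epd, h1, h2, ← Finset.mul_sum]
  ring

theorem epd_sum {ι : Type*} (s : Finset ι) {v : ι → EuclideanSpace ℝ (Fin n) × ℝ → ℝ}
    (hv : ∀ i ∈ s, IsTest (v i)) (z : EuclideanSpace ℝ (Fin n) × ℝ) :
    epd (fun z => ∑ i ∈ s, v i z) z = ∑ i ∈ s, epd (v i) z := by
  classical
  induction s using Finset.induction_on with
  | empty => simpa using epd_zero z
  | insert a s ha ih =>
    simp only [Finset.sum_insert ha]
    rw [(hv a (by simp)).epd_add (IsTest.sum s fun i hi => hv i (by simp [hi])),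
      ih fun i hi => hv i (by simp [hi])]

/-- Multiplying a test function by a rescaled cutoff costs two inverse powers of the scale. -/
theorem exists_epd_mul_scale_bound (hv : IsTest v) {θ : EuclideanSpace ℝ (Fin n) × ℝ → ℝ}
    (hθ : ContDiff ℝ 2 θ) (hθs : HasCompactSupport θ) :
    ∃ C, ∀ a : ℝ, 1 ≤ a → ∀ c z, |epd (fun y => v y * θ (a • y + c)) z| ≤ C * a ^ 2 := by
  have b1 : ∀ e, ∃ C, 0 ≤ C ∧ ∀ z, |dirD e v z| ≤ C := fun e =>
    exists_bound_of_hasCompactSupport (hv.contDiff_dirD e).continuous hv.compact.dirD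
  have b2 : ∀ e, ∃ C, 0 ≤ C ∧ ∀ z, |dirD e (dirD e v) z| ≤ C := fun e =>
    exists_bound_of_hasCompactSupport (hv.continuous_dirD_dirD e e) hv.compact.dirD.dirD
  have b3 : ∀ e, ∃ C, 0 ≤ C ∧ ∀ z, |dirD e θ z| ≤ C := fun e =>
    exists_bound_of_hasCompactSupport (hθ.dirD (m := 1) (by norm_num)).continuous hθs.dirD
  have b4 : ∀ e, ∃ C, 0 ≤ C ∧ ∀ z, |dirD e (dirD e θ) z| ≤ C := fun e =>
    exists_bound_of_hasCompactSupport
      ((hθ.dirD (m := 1) (by norm_num)).dirD (m := 0) (by norm_num)).continuous hθs.dirD.dirD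
  obtain ⟨A0, hA0, A0b⟩ := exists_bound_of_hasCompactSupport hv.contDiff.continuous hv.compact
  obtain ⟨B0, hB0, B0b⟩ := exists_bound_of_hasCompactSupport hθ.continuous hθs
  obtain ⟨Q0, hQ0, Q0b⟩ := exists_bound_div_time hv.contDiff.continuous hv.compact hv.pos
  obtain ⟨Q1, hQ1, Q1b⟩ := exists_bound_div_time (hv.contDiff_dirD (0, 1)).continuous
    hv.compact.dirD (hv.pos_dirD _)
  choose A1 hA1 A1b using b1
  choose A2 hA2 A2b using b2
  choose B1 hB1 B1b using b3
  choose B2 hB2 B2b using b4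
  let K : EuclideanSpace ℝ (Fin n) × ℝ → ℝ := fun e => A2 e * B0 + 2 * (A1 e * B1 e) + A0 * B2 e
  refine ⟨K (0, 1) + |(n : ℝ) - 1| * (Q1 * B0 + Q0 * B1 (0, 1))
    + ∑ i : Fin n, K (EuclideanSpace.single i (1 : ℝ), (0 : ℝ)), fun a ha c z => ?_⟩
  have hsc : ContDiff ℝ 2 (fun y => θ (a • y + c)) := hθ.comp (by fun_prop)
  have ha0 : 0 ≤ a := by linarith
  have haa : a ≤ a ^ 2 := by nlinarith
  have ha1 : 1 ≤ a ^ 2 := by nlinarith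
  have hK : ∀ e, |dirD e (dirD e (fun y => v y * θ (a • y + c))) z| ≤ K e * a ^ 2 := by
    intro e
    rw [dirD_dirD_mul hv.contDiff hsc, dirD_dirD_scale a c hθ,
      dirD_scale a c (hθ.differentiable (by norm_num))]
    have e1 : |dirD e (dirD e v) z * θ (a • z + c)| ≤ A2 e * B0 * a ^ 2 := by
      rw [abs_mul]
      calc _ ≤ A2 e * B0 := mul_le_mul (A2b e z) (B0b _) (abs_nonneg _) (hA2 e)
        _ ≤ _ := le_mul_of_one_le_right (mul_nonneg (hA2 e) hB0) ha1
    have e2 : |2 * (dirD e v z * (a * dirD e θ (a • z + c)))| ≤ 2 * (A1 e * B1 e) * a ^ 2 := by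
      rw [abs_mul, abs_mul, abs_mul, abs_of_nonneg ha0, abs_two]
      have : |dirD e v z| * |dirD e θ (a • z + c)| ≤ A1 e * B1 e :=
        mul_le_mul (A1b e z) (B1b e _) (abs_nonneg _) (hA1 e)
      calc _ = 2 * (|dirD e v z| * |dirD e θ (a • z + c)|) * a := by ring
        _ ≤ 2 * (A1 e * B1 e) * a ^ 2 :=
          mul_le_mul (by linarith) haa ha0 (by have := mul_nonneg (hA1 e) (hB1 e); linarith)
    have e3 : |v z * (a ^ 2 * dirD e (dirD e θ) (a • z + c))| ≤ A0 * B2 e * a ^ 2 := by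
      rw [abs_mul, abs_mul, abs_of_nonneg (sq_nonneg a)]
      have : |v z| * |dirD e (dirD e θ) (a • z + c)| ≤ A0 * B2 e :=
        mul_le_mul (A0b z) (B2b e _) (abs_nonneg _) hA0
      calc _ = (|v z| * |dirD e (dirD e θ) (a • z + c)|) * a ^ 2 := by ring
        _ ≤ _ := by gcongr
    calc _ ≤ _ := (abs_add_le _ _).trans (add_le_add_left (abs_add_le _ _) _)
      _ ≤ A2 e * B0 * a ^ 2 + 2 * (A1 e * B1 e) * a ^ 2 + A0 * B2 e * a ^ 2 := by gcongr
      _ = K e * a ^ 2 := by simp only [K]; ring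
  have hL : |((n : ℝ) - 1) * (dirD (0, 1) (fun y => v y * θ (a • y + c)) z / z.2)|
      ≤ |(n : ℝ) - 1| * (Q1 * B0 + Q0 * B1 (0, 1)) * a ^ 2 := by
    rw [abs_mul, mul_assoc]
    refine mul_le_mul_of_nonneg_left ?_ (abs_nonneg _)
    rw [dirD_mul (hv.contDiff.differentiable (by norm_num) z)
      (hsc.differentiable (by norm_num) z), dirD_scale a c (hθ.differentiable (by norm_num))]
    have : (dirD (0, 1) v z * θ (a • z + c) + v z * (a * dirD (0, 1) θ (a • z + c))) / z.2
      = (dirD (0, 1) v z / z.2) * θ (a • z + c)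
        + a * ((v z / z.2) * dirD (0, 1) θ (a • z + c)) := by ring
    rw [this]
    have e1 : |(dirD (0, 1) v z / z.2) * θ (a • z + c)| ≤ Q1 * B0 := by
      rw [abs_mul]
      exact mul_le_mul (Q1b z) (B0b _) (abs_nonneg _) hQ1
    have e2 : |(v z / z.2) * dirD (0, 1) θ (a • z + c)| ≤ Q0 * B1 (0, 1) := by
      rw [abs_mul]
      exact mul_le_mul (Q0b z) (B1b _ _) (abs_nonneg _) hQ0
    calc _ ≤ _ := abs_add_le _ _
      _ ≤ Q1 * B0 * a ^ 2 + a ^ 2 * (Q0 * B1 (0, 1)) := by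
        refine add_le_add (e1.trans (le_mul_of_one_le_right (mul_nonneg hQ1 hB0) ha1)) ?_
        rw [abs_mul, abs_of_nonneg ha0]
        exact mul_le_mul haa e2 (abs_nonneg _) (by positivity)
      _ = _ := by ring
  calc _ ≤ _ := (abs_sub _ _).trans (add_le_add (abs_add_le _ _) (Finset.abs_sum_le_sum_abs _ _))
    _ ≤ K (0, 1) * a ^ 2 + |(n : ℝ) - 1| * (Q1 * B0 + Q0 * B1 (0, 1)) * a ^ 2
      + ∑ i : Fin n, K (EuclideanSpace.single i (1 : ℝ), (0 : ℝ)) * a ^ 2 :=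
        add_le_add (add_le_add (hK _) hL) (Finset.sum_le_sum fun i _ => hK _)
    _ = _ := by rw [← Finset.sum_mul]; ring

end IsTest

end EPD

/-! ### Spherical means as weak solutions. -/

section WeakEquation

open Set Filter Topology Metric

variable {n : ℕ}

/-- The spherical mean transform, written as an integral over the unit sphere. -/
def sphMean (f : EuclideanSpace ℝ (Fin n) → ℝ) (z : EuclideanSpace ℝ (Fin n) × ℝ) : ℝ :=
  z.2 ^ (n - 1) * ∫ ω : sphere (0 : EuclideanSpace ℝ (Fin n)) 1,
    f (z.1 + z.2 • (ω : EuclideanSpace ℝ (Fin n))) ∂(volume : Measure _).toSphere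

theorem sphericalMeanTransform_eq_sphMean {f : EuclideanSpace ℝ (Fin n) → ℝ} (hf : Continuous f)
    {z : EuclideanSpace ℝ (Fin n) × ℝ} (hz : 0 ≤ z.2) :
    sphericalMeanTransform f z = sphMean f z := by
  have hc : Continuous fun ω : sphere (0 : EuclideanSpace ℝ (Fin n)) 1 =>
      z.1 + z.2 • (ω : EuclideanSpace ℝ (Fin n)) := by fun_prop
  rw [sphericalMeanTransform, sphereSurfaceMeasure, integral_smul_measure,
    integral_map hc.aemeasurable hf.aestronglyMeasurable, ENNReal.toReal_ofReal (by positivity)]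
  rfl

theorem continuous_sphMean {f : EuclideanSpace ℝ (Fin n) → ℝ} (hf : Continuous f) :
    Continuous (sphMean f) := by
  refine (continuous_snd.pow _).mul ?_
  have := continuous_parametric_integral_of_continuous
    (μ := (volume : Measure (EuclideanSpace ℝ (Fin n))).toSphere)
    (f := fun (z : EuclideanSpace ℝ (Fin n) × ℝ)
      (ω : sphere (0 : EuclideanSpace ℝ (Fin n)) 1) =>
        f (z.1 + z.2 • (ω : EuclideanSpace ℝ (Fin n))))
    (by fun_prop) isCompact_univ
  simpa using this

/-- Integration in polar coordinates. -/
theorem integral_eq_integral_polar (hn : 1 ≤ n) {h : EuclideanSpace ℝ (Fin n) → ℝ}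
    (hh : Integrable h) :
    ∫ y, h y = ∫ t in Ioi (0 : ℝ), t ^ (n - 1) *
      ∫ ω : sphere (0 : EuclideanSpace ℝ (Fin n)) 1,
        h (t • (ω : EuclideanSpace ℝ (Fin n))) ∂(volume : Measure _).toSphere := by
  have hd : Module.finrank ℝ (EuclideanSpace ℝ (Fin n)) = n := finrank_euclideanSpace_fin
  have : Nonempty (Fin n) := ⟨⟨0, hn⟩⟩
  have hmp := (volume : Measure (EuclideanSpace ℝ
    (Fin n))).measurePreserving_homeomorphUnitSphereProd
  rw [hd] at hmp
  have hemb := (homeomorphUnitSphereProd (EuclideanSpace ℝ (Fin n))).measurableEmbedding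
  let H : sphere (0 : EuclideanSpace ℝ (Fin n)) 1 × Ioi (0 : ℝ) → ℝ :=
    fun q => h (q.2.1 • (q.1 : EuclideanSpace ℝ (Fin n)))
  have hH : ∀ y : ({(0)}ᶜ : Set (EuclideanSpace ℝ (Fin n))),
      H (homeomorphUnitSphereProd _ y) = h y := by
    intro y
    have hy : ‖(y : EuclideanSpace ℝ (Fin n))‖ ≠ 0 := norm_ne_zero_iff.2 y.2
    simp only [H, homeomorphUnitSphereProd_apply_snd_coe, homeomorphUnitSphereProd_apply_fst_coe]
    rw [smul_smul, mul_inv_cancel₀ hy, one_smul]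
  have h0 : MeasurableSet ({(0)}ᶜ : Set (EuclideanSpace ℝ (Fin n))) :=
    (measurableSet_singleton _).compl
  have hint : Integrable H ((volume : Measure _).toSphere.prod (.volumeIoiPow (n - 1))) := by
    rw [← hmp.integrable_comp_emb hemb]
    have : H ∘ homeomorphUnitSphereProd _
        = h ∘ ((↑) : ({(0)}ᶜ : Set (EuclideanSpace ℝ (Fin n))) → EuclideanSpace ℝ (Fin n)) :=
          funext hH
    rw [this, ← integrableOn_iff_comap_subtypeVal h0]
    exact hh.integrableOn
  calc ∫ y, h y = ∫ y : ({(0)}ᶜ : Set (EuclideanSpace ℝ (Fin n))), h y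
      ∂(volume.comap Subtype.val) := by
        rw [integral_subtype_comap h0 fun x => h x, restrict_compl_singleton]
    _ = ∫ q, H q ∂((volume : Measure _).toSphere.prod (.volumeIoiPow (n - 1))) := by
        rw [← hmp.integral_comp hemb]
        exact integral_congr_ae (Eventually.of_forall fun y => (hH y).symm)
    _ = ∫ t : Ioi (0 : ℝ), ∫ ω, H (ω, t) ∂(volume : Measure _).toSphere
          ∂(.volumeIoiPow (n - 1)) := integral_prod_symm _ hint
    _ = _ := by
        simp only [Measure.volumeIoiPow, ENNReal.ofReal]
        rw [integral_withDensity_eq_integral_smul,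
          integral_subtype_comap measurableSet_Ioi fun a : ℝ => Real.toNNReal (a ^ (n - 1)) •
            ∫ ω : sphere (0 : EuclideanSpace ℝ (Fin n)) 1,
              h (a • (ω : EuclideanSpace ℝ (Fin n))) ∂(volume : Measure _).toSphere]
        · refine setIntegral_congr_fun measurableSet_Ioi fun x hx => ?_
          simp only [NNReal.smul_def, Real.coe_toNNReal _ (pow_nonneg (le_of_lt hx) _), smul_eq_mul]
        · exact (measurable_subtype_coe.pow_const _).real_toNNReal

/-- Chain rule on the cone t = |x - y|. The vertex x = y, where the norm is not differentiable, is
harmless: there t = 0, so `G` vanishes nearby. -/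
theorem hasLineDerivAt_comp_norm {G : EuclideanSpace ℝ (Fin n) × ℝ → ℝ} (hG : ContDiff ℝ 1 G)
    (hpos : ∀ z ∈ tsupport G, 0 < z.2) (y x : EuclideanSpace ℝ (Fin n)) (i : Fin n) :
    HasLineDerivAt ℝ (fun x => G (x, ‖x - y‖))
      (dirD (EuclideanSpace.single i (1 : ℝ), (0 : ℝ)) G (x, ‖x - y‖)
        + (x i - y i) * (dirD (0, 1) G (x, ‖x - y‖) / ‖x - y‖)) x
      (EuclideanSpace.single i (1 : ℝ)) := by
  by_cases hxy : x = y
  · subst hxy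
    have hn : (x, ‖x - x‖) ∉ tsupport G := fun h => by simpa using hpos _ h
    have h0 : (fun z => G (z, ‖z - x‖)) =ᶠ[𝓝 x] fun _ => 0 := by
      have hc : ContinuousAt (fun z : EuclideanSpace ℝ (Fin n) => (z, ‖z - x‖)) x := by fun_prop
      exact hc.eventually (notMem_tsupport_iff_eventuallyEq.1 hn)
    rw [(dirD_eq_zero_of_notMem_tsupport hn).eq_of_nhds]
    refine HasLineDerivAt.congr_of_eventuallyEq ?_ h0
    simpa using (hasFDerivAt_const (0 : ℝ) x).hasLineDerivAt _
  · have hne : x - y ≠ 0 := sub_ne_zero.2 hxy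
    have hr : 0 < ‖x - y‖ := norm_pos_iff.2 hne
    have hn : HasFDerivAt (fun x => ‖x - y‖) (‖x - y‖⁻¹ • innerSL ℝ (x - y)) x := by
      have h1 := (((hasFDerivAt_id x).sub_const y).norm_sq).sqrt
        (by simpa using hne)
      simp only [id] at h1
      have h2 : (fun x : EuclideanSpace ℝ (Fin n) => √(‖x - y‖ ^ 2)) = fun x => ‖x - y‖ := by
        funext x; exact Real.sqrt_sq (norm_nonneg _)
      rw [h2] at h1
      refine h1.congr_fderiv ?_
      ext w
      simp [Real.sqrt_sq (norm_nonneg _)]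
      field_simp
    have hc := ((hG.differentiable (by norm_num)) (x, ‖x - y‖)).hasFDerivAt.comp x
      ((hasFDerivAt_id x).prodMk hn)
    have hl := hc.hasLineDerivAt (EuclideanSpace.single i (1 : ℝ))
    refine HasDerivAt.congr_deriv hl ?_
    simp only [dirD, ContinuousLinearMap.comp_apply, ContinuousLinearMap.prod_apply,
      smul_apply, innerSL_apply_apply]
    rw [EuclideanSpace.inner_single_right]
    have : ((ContinuousLinearMap.id ℝ (EuclideanSpace ℝ (Fin n))) (EuclideanSpace.single i (1 : ℝ)),
        ‖x - y‖⁻¹ • (1 * (starRingEnd ℝ) ((x - y) i)))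
      = ((EuclideanSpace.single i (1 : ℝ), (0 : ℝ)) : EuclideanSpace ℝ (Fin n) × ℝ)
        + (‖x - y‖⁻¹ * (x i - y i)) • ((0 : EuclideanSpace ℝ (Fin n)), (1 : ℝ)) := by
      simp
    rw [this, map_add, map_smul, smul_eq_mul]
    field_simp

theorem contDiff_div_time {g : EuclideanSpace ℝ (Fin n) × ℝ → ℝ} (hg : ContDiff ℝ 1 g)
    (hpos : ∀ z ∈ tsupport g, 0 < z.2) : ContDiff ℝ 1 fun z => g z / z.2 := by
  rw [contDiff_iff_contDiffAt]
  intro z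
  by_cases hz : z ∈ tsupport g
  · exact hg.contDiffAt.div contDiff_snd.contDiffAt (hpos z hz).ne'
  · have h0 : g =ᶠ[𝓝 z] 0 := notMem_tsupport_iff_eventuallyEq.1 hz
    have : (fun z => g z / z.2) =ᶠ[𝓝 z] fun _ => 0 := by
      filter_upwards [h0] with y hy
      simp [hy]
    exact contDiffAt_const.congr_of_eventuallyEq this

theorem tsupport_div_time_subset (g : EuclideanSpace ℝ (Fin n) × ℝ → ℝ) :
    tsupport (fun z => g z / z.2) ⊆ tsupport g := by
  refine closure_mono fun z hz => ?_
  contrapose! hz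
  simp [Function.notMem_support.1 hz]

theorem dirD_comm {V : Type*} [NormedAddCommGroup V] [NormedSpace ℝ V] {v : V → ℝ}
    (hv : ContDiff ℝ 2 v) (e e' z : V) :
    dirD e (dirD e' v) z = dirD e' (dirD e v) z := by
  have hd : DifferentiableAt ℝ (fderiv ℝ v) z :=
    (hv.fderiv_right (m := 1) (by norm_num)).differentiable (by norm_num) z
  have h1 : ∀ e e' : V, dirD e (dirD e' v) z = fderiv ℝ (fderiv ℝ v) z e e' := by
    intro e e'
    have := (hd.hasFDerivAt.clm_apply (hasFDerivAt_const e' z)).fderiv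
    rw [dirD, show dirD e' v = fun y => fderiv ℝ v y e' from rfl, this]
    simp
  rw [h1, h1]
  exact (hv.contDiffAt.isSymmSndFDerivAt (by simp)) e e'

theorem dirD_div_time {g : EuclideanSpace ℝ (Fin n) × ℝ → ℝ} (hg : ContDiff ℝ 1 g)
    {z e : EuclideanSpace ℝ (Fin n) × ℝ} (hz : z.2 ≠ 0) :
    dirD e (fun z => g z / z.2) z = dirD e g z / z.2 - g z * e.2 / z.2 ^ 2 := by
  have h1 : HasFDerivAt (fun z : EuclideanSpace ℝ (Fin n) × ℝ => z.2)
      (ContinuousLinearMap.snd ℝ _ _) z := hasFDerivAt_snd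
  have h2 := (hasDerivAt_inv hz).comp_hasFDerivAt z h1
  have h3 := ((hg.differentiable (by norm_num) z).hasFDerivAt.mul h2).fderiv
  have h4 : (fun z => g z / z.2) = g * (Inv.inv ∘ fun z => z.2) := by
    funext z; simp [div_eq_mul_inv]
  rw [dirD, h4, h3]
  simp [dirD]
  field_simp
  ring

theorem hasCompactSupport_comp_norm {G : EuclideanSpace ℝ (Fin n) × ℝ → ℝ}
    (hG : HasCompactSupport G) (y : EuclideanSpace ℝ (Fin n)) :
    HasCompactSupport fun x => G (x, ‖x - y‖) := by
  refine HasCompactSupport.intro (hG.isCompact.image continuous_fst) fun x hx => ?_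
  by_contra h
  exact hx ⟨(x, ‖x - y‖), subset_tsupport _ h, rfl⟩

/-- With r = |x - y|, the restriction of `epd v` to the cone is the divergence in x of (v_t / r)(x -
y) - ∇v, evaluated at (x, r). The mixed derivatives v_{ti} from the two terms cancel, and n v_t / r
- v_t / r leaves the factor n - 1. -/
theorem IsTest.integral_epd_cone_eq_zero {v : EuclideanSpace ℝ (Fin n) × ℝ → ℝ} (hv : IsTest v)
    (y : EuclideanSpace ℝ (Fin n)) : ∫ x, epd v (x, ‖x - y‖) = 0 := by
  let e : Fin n → EuclideanSpace ℝ (Fin n) × ℝ := fun i => (EuclideanSpace.single i (1 : ℝ), 0)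
  let Q : EuclideanSpace ℝ (Fin n) × ℝ → ℝ := fun z => dirD (0, 1) v z / z.2
  have hQ : ContDiff ℝ 1 Q := contDiff_div_time (hv.contDiff_dirD _) (hv.pos_dirD _)
  have hQp : ∀ z ∈ tsupport Q, 0 < z.2 := fun z hz =>
    hv.pos_dirD _ z (tsupport_div_time_subset _ hz)
  have hQc : HasCompactSupport Q :=
    (hv.compact.dirD (e := (0, 1))).mono' ((subset_tsupport _).trans (tsupport_div_time_subset _))
  let X : Fin n → EuclideanSpace ℝ (Fin n) → ℝ := fun i x =>
    (fun x => Q (x, ‖x - y‖)) x * (x i - y i) - dirD (e i) v (x, ‖x - y‖)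
  let X' : Fin n → EuclideanSpace ℝ (Fin n) → ℝ := fun i x =>
    ((dirD (e i) Q (x, ‖x - y‖) + (x i - y i) * (dirD (0, 1) Q (x, ‖x - y‖) / ‖x - y‖))
      * (x i - y i) + Q (x, ‖x - y‖) * 1)
    - (dirD (e i) (dirD (e i) v) (x, ‖x - y‖)
      + (x i - y i) * (dirD (0, 1) (dirD (e i) v) (x, ‖x - y‖) / ‖x - y‖))
  have hΦ : Continuous fun x : EuclideanSpace ℝ (Fin n) => (x, ‖x - y‖) := by fun_prop
  have hdiv : ∀ {g : EuclideanSpace ℝ (Fin n) × ℝ → ℝ}, Continuous g →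
      (∀ z ∈ tsupport g, 0 < z.2) → Continuous fun x => g (x, ‖x - y‖) / ‖x - y‖ :=
    fun hg hp => (continuous_div_time hg hp).comp hΦ
  have hXi : ∀ i, Continuous (X' i) := by
    intro i
    have hci : Continuous fun x : EuclideanSpace ℝ (Fin n) => x i - y i := by fun_prop
    have c1 : Continuous fun x => dirD (e i) Q (x, ‖x - y‖) :=
      (hQ.dirD (m := 0) (by norm_num)).continuous.comp hΦ
    have c2 : Continuous fun x => dirD (0, 1) Q (x, ‖x - y‖) / ‖x - y‖ :=
      hdiv (hQ.dirD (m := 0) (by norm_num)).continuous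
        fun z hz => hQp z (tsupport_dirD_subset _ _ hz)
    have c3 : Continuous fun x => dirD (e i) (dirD (e i) v) (x, ‖x - y‖) :=
      (hv.continuous_dirD_dirD _ _).comp hΦ
    have c4 : Continuous fun x => dirD (0, 1) (dirD (e i) v) (x, ‖x - y‖) / ‖x - y‖ :=
      hdiv (hv.continuous_dirD_dirD _ _)
        fun z hz => hv.pos_dirD _ z (tsupport_dirD_subset _ _ hz)
    have c5 : Continuous fun x => Q (x, ‖x - y‖) := hQ.continuous.comp hΦ
    exact (((c1.add (hci.mul c2)).mul hci).add (c5.mul continuous_const)).sub (c3.add (hci.mul c4))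
  have hXs : ∀ i, HasCompactSupport (X i) := fun i =>
    (hasCompactSupport_comp_norm hQc y).mul_right.sub
      (hasCompactSupport_comp_norm hv.compact.dirD y)
  have hXc : ∀ i, Continuous (X i) := by
    intro i
    have hci : Continuous fun x : EuclideanSpace ℝ (Fin n) => x i - y i := by fun_prop
    exact ((hQ.continuous.comp hΦ).mul hci).sub ((hv.contDiff_dirD _).continuous.comp hΦ)
  have hline : ∀ i x, HasLineDerivAt ℝ (X i) (X' i x) x (EuclideanSpace.single i (1 : ℝ)) := by
    intro i x
    have h1 := hasLineDerivAt_comp_norm hQ hQp y x i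
    have h2 := hasLineDerivAt_comp_norm (hv.contDiff_dirD (e i)) (hv.pos_dirD (e i)) y x i
    have h3 : HasLineDerivAt ℝ (fun x : EuclideanSpace ℝ (Fin n) => x i - y i) 1 x
        (EuclideanSpace.single i (1 : ℝ)) := by
      have : HasFDerivAt (fun x : EuclideanSpace ℝ (Fin n) => x i - y i)
          (EuclideanSpace.proj i : EuclideanSpace ℝ (Fin n) →L[ℝ] ℝ) x :=
        (EuclideanSpace.proj i : EuclideanSpace ℝ (Fin n) →L[ℝ] ℝ).hasFDerivAt.sub_const _
      simpa using this.hasLineDerivAt (EuclideanSpace.single i (1 : ℝ))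
    have h4 := (HasDerivAt.mul h1 h3).sub h2
    simp only [zero_smul, add_zero] at h4
    exact h4
  have hzero : ∀ i, ∫ x, X' i x = 0 := fun i =>
    integral_eq_zero_of_hasLineDerivAt (hXc i) (hXs i) (hXi i) (hline i)
  have hXs' : ∀ i, HasCompactSupport (X' i) := by
    intro i
    refine (hXs i).mono' fun x hx => ?_
    by_contra hx'
    apply hx
    have h0 : X i =ᶠ[𝓝 x] fun _ => 0 := notMem_tsupport_iff_eventuallyEq.1 hx'
    exact (hline i x).unique (HasLineDerivAt.congr_of_eventuallyEq
      (by simpa using (hasFDerivAt_const (0 : ℝ) x).hasLineDerivAt _) h0)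
  have hsum : ∀ x, epd v (x, ‖x - y‖) = ∑ i, X' i x := by
    intro x
    by_cases hxy : x = y
    · subst hxy
      have hz : ((x, ‖x - x‖) : EuclideanSpace ℝ (Fin n) × ℝ) ∉ tsupport v := fun h => by
        simpa using hv.pos _ h
      have hzQ : ((x, ‖x - x‖) : EuclideanSpace ℝ (Fin n) × ℝ) ∉ tsupport Q := fun h => by
        simpa using hQp _ h
      rw [epd_eq_zero_of_notMem_tsupport hz]
      symm
      refine Finset.sum_eq_zero fun i _ => ?_
      have hz' : ((x, ‖x - x‖) : EuclideanSpace ℝ (Fin n) × ℝ) ∉ tsupport (dirD (e i) v) :=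
        fun h => hz (tsupport_dirD_subset _ _ h)
      simp only [X', (dirD_eq_zero_of_notMem_tsupport hzQ).eq_of_nhds,
        (dirD_eq_zero_of_notMem_tsupport hz').eq_of_nhds, image_eq_zero_of_notMem_tsupport hzQ]
      simp
    · have hr : ‖x - y‖ ≠ 0 := norm_ne_zero_iff.2 (sub_ne_zero.2 hxy)
      have hrs : ∑ i, (x i - y i) ^ 2 = ‖x - y‖ ^ 2 := by
        rw [EuclideanSpace.norm_sq_eq]
        simp
      have hterm : ∀ i, X' i x =
          (x i - y i) ^ 2 * ((dirD (0, 1) (dirD (0, 1) v) (x, ‖x - y‖)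
            - dirD (0, 1) v (x, ‖x - y‖) / ‖x - y‖) / ‖x - y‖ ^ 2)
          + dirD (0, 1) v (x, ‖x - y‖) / ‖x - y‖ - dirD (e i) (dirD (e i) v) (x, ‖x - y‖) := by
        intro i
        simp only [X', Q]
        rw [dirD_div_time (hv.contDiff_dirD _) hr, dirD_div_time (hv.contDiff_dirD _) hr,
          dirD_comm hv.contDiff (0, 1) (e i)]
        simp only [e]
        field_simp
        ring
      rw [Finset.sum_congr rfl fun i _ => hterm i, Finset.sum_sub_distrib, Finset.sum_add_distrib,
        ← Finset.sum_mul, hrs]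
      simp only [epd, e, Finset.sum_const, Finset.card_univ, Fintype.card_fin, nsmul_eq_mul]
      field_simp
      ring
  simp_rw [hsum]
  rw [integral_finsetSum _ fun i _ => (hXi i).integrable_of_hasCompactSupport (hXs' i)]
  simp [hzero]

/-- The spherical mean transform of a continuous function is a weak solution of the
Euler–Poisson–Darboux equation in the half-space `t > 0`. -/
theorem integral_sphMean_mul_epd (hn : 1 ≤ n) {f : EuclideanSpace ℝ (Fin n) → ℝ}
    (hf : Continuous f) {v : EuclideanSpace ℝ (Fin n) × ℝ → ℝ} (hv : IsTest v) :
    ∫ z, sphMean f z * epd v z = 0 := by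
  obtain ⟨R, hR⟩ := hv.hasCompactSupport_epd.isCompact.isBounded.subset_closedBall 0
  have hR' : ∀ z, epd v z ≠ 0 → ‖z‖ ≤ R := fun z hz => by
    simpa using hR (subset_tsupport _ hz)
  -- Polar coordinates about x: the factor t^(n-1) in `sphMean` is the Jacobian, and t becomes |x -
  -- y|.
  have hinner : ∀ x, ∫ t, sphMean f (x, t) * epd v (x, t)
      = ∫ y, f y * epd v (x, ‖x - y‖) := by
    intro x
    have hc : Continuous fun y : EuclideanSpace ℝ (Fin n) => f (x + y) * epd v (x, ‖y‖) :=
      (hf.comp (by fun_prop)).mul (hv.continuous_epd.comp (by fun_prop))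
    have hs : HasCompactSupport
        fun y : EuclideanSpace ℝ (Fin n) => f (x + y) * epd v (x, ‖y‖) := by
      refine HasCompactSupport.intro (isCompact_closedBall 0 R) fun y hy => ?_
      by_contra h
      have := hR' _ (right_ne_zero_of_mul h)
      apply hy
      rw [mem_closedBall_zero_iff]
      exact (le_trans (by simp) (norm_snd_le _)).trans this
    have hp := integral_eq_integral_polar hn (hc.integrable_of_hasCompactSupport hs)
    have h1 : ∫ t, sphMean f (x, t) * epd v (x, t)
        = ∫ t in Ioi (0 : ℝ), sphMean f (x, t) * epd v (x, t) := by
      symm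
      refine setIntegral_eq_integral_of_forall_compl_eq_zero fun t ht => ?_
      rw [epd_eq_zero_of_notMem_tsupport (z := (x, t)) fun h => ht (hv.pos _ h), mul_zero]
    rw [h1]
    have h2 : ∫ y, f y * epd v (x, ‖x - y‖) = ∫ y, f (x + y) * epd v (x, ‖y‖) := by
      rw [← integral_add_left_eq_self _ x]
      simp
    rw [h2, hp]
    refine setIntegral_congr_fun measurableSet_Ioi fun t ht => ?_
    have ht' : (0 : ℝ) < t := ht
    simp only [sphMean]
    have : ∀ ω : sphere (0 : EuclideanSpace ℝ (Fin n)) 1,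
        ‖t • (ω : EuclideanSpace ℝ (Fin n))‖ = t := by
      intro ω
      rw [norm_smul]
      simp [abs_of_pos ht']
    simp_rw [this]
    rw [integral_mul_const]
    ring
  have hint : Integrable fun z => sphMean f z * epd v z :=
    ((continuous_sphMean hf).mul hv.continuous_epd).integrable_of_hasCompactSupport
      hv.hasCompactSupport_epd.mul_left
  rw [Measure.volume_eq_prod] at hint ⊢
  rw [integral_prod _ hint]
  simp_rw [hinner]
  rw [integral_integral_swap]
  · simp_rw [integral_const_mul, hv.integral_epd_cone_eq_zero]
    simp
  · have hc : Continuous (Function.uncurry fun x y : EuclideanSpace ℝ (Fin n) =>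
        f y * epd v (x, ‖x - y‖)) :=
      (hf.comp continuous_snd).mul (hv.continuous_epd.comp (by fun_prop))
    rw [← Measure.volume_eq_prod]
    refine hc.integrable_of_hasCompactSupport
      -- The support of `epd v` bounds both |x| and |x - y| by R, hence |y| by 2R.
      (HasCompactSupport.intro (isCompact_closedBall 0 (2 * R)) fun q hq => ?_)
    by_contra h
    have h3 := hR' _ (right_ne_zero_of_mul h)
    apply hq
    have h4 : ‖q.1‖ ≤ R := (norm_fst_le (q.1, ‖q.1 - q.2‖)).trans h3
    have h5 : ‖q.1 - q.2‖ ≤ R := by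
      have := (norm_snd_le (q.1, ‖q.1 - q.2‖)).trans h3
      simpa using this
    rw [mem_closedBall_zero_iff, Prod.norm_def]
    refine max_le (by linarith [norm_nonneg q.1]) ?_
    calc ‖q.2‖ = ‖q.1 - (q.1 - q.2)‖ := by simp
      _ ≤ _ := norm_sub_le _ _
      _ ≤ 2 * R := by linarith

end WeakEquation

/-! ### Space-like surfaces are global Lipschitz graphs. -/

section Graph

open Set Filter Topology Metric

variable {n : ℕ}

/-- Every zero is an upward crossing. After the zero a the function stays nonnegative, whereas just
before a second zero b it would be negative. -/
theorem unique_zero_of_deriv_pos {g g' : ℝ → ℝ} (hg : ∀ t, HasDerivAt g (g' t) t)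
    (hpos : ∀ t, g t = 0 → 0 < g' t) {a b : ℝ} (ha : g a = 0) (hb : g b = 0) : a = b := by
  wlog hab : a < b generalizing a b
  · rcases eq_or_lt_of_le (not_lt.1 hab) with h | h
    · exact h.symm
    · exact (this hb ha h).symm
  exfalso
  have hnn : ∀ ⦃x⦄, x ∈ Icc a b → 0 ≤ g x :=
    image_le_of_deriv_right_lt_deriv_boundary (f := fun _ => (0 : ℝ)) (f' := fun _ => 0)
      continuousOn_const (fun x _ => hasDerivWithinAt_const _ _ _) ha.ge hg
      (fun x _ h => hpos x h.symm)
  have h1 : ∀ᶠ s in 𝓝[<] b, g s < 0 := by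
    have h2 := (hasDerivAt_iff_tendsto_slope.1 (hg b)).mono_left
      (nhdsWithin_mono b (fun s (hs : s < b) => hs.ne))
    filter_upwards [h2.eventually (lt_mem_nhds (hpos b hb)), self_mem_nhdsWithin] with s hs hsb
    rw [slope_def_field, hb, sub_zero] at hs
    by_contra hcon
    exact absurd hs (not_lt.2 (div_nonpos_of_nonneg_of_nonpos (not_lt.1 hcon)
      (sub_nonpos.2 (le_of_lt hsb))))
  obtain ⟨s, hs, hs'⟩ := (h1.and (Ioo_mem_nhdsLT hab)).exists
  exact absurd (hnn ⟨hs'.1.le, hs'.2.le⟩) (not_le.2 hs)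

/-- Cauchy–Schwarz turns the space-like condition on the coordinates of the normal into a slope
bound in every spatial direction. -/
theorem fderiv_single_bound {L : EuclideanSpace ℝ (Fin n) × ℝ →L[ℝ] ℝ}
    (h : ∑ i : Fin n, (L (EuclideanSpace.single i (1 : ℝ), (0 : ℝ))) ^ 2 ≤ (L (0, 1)) ^ 2)
    (e : EuclideanSpace ℝ (Fin n)) : |L (e, 0)| ≤ ‖e‖ * |L (0, 1)| := by
  have he : L (e, 0) = ∑ i, e i * L (EuclideanSpace.single i (1 : ℝ), (0 : ℝ)) := by
    have h1 : (e, (0 : ℝ)) = ∑ i, e i • ((EuclideanSpace.single i (1 : ℝ), (0 : ℝ)) :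
        EuclideanSpace ℝ (Fin n) × ℝ) := by
      refine Prod.ext ?_ ?_
      · rw [Prod.fst_sum]
        have := (EuclideanSpace.basisFun (Fin n) ℝ).sum_repr e
        simpa using this.symm
      · simp [Prod.snd_sum]
    rw [h1, map_sum]
    simp only [map_smul, smul_eq_mul]
  have h2 : (L (e, 0)) ^ 2 ≤ ‖e‖ ^ 2 * (L (0, 1)) ^ 2 := by
    rw [he, EuclideanSpace.norm_sq_eq]
    simp only [Real.norm_eq_abs, sq_abs]
    exact (Finset.sum_mul_sq_le_sq_mul_sq _ _ _).trans
      (mul_le_mul_of_nonneg_left h (Finset.sum_nonneg fun i _ => sq_nonneg _))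
  refine abs_le_of_sq_le_sq ?_ (by positivity)
  rw [mul_pow, sq_abs]
  exact h2

/-- On each vertical line F has at most one zero. A zero over x can be followed along the segment to
any y, because the slope bound prevents it from escaping to infinity. The space-like condition
allows slope 1; the constant 2 leaves room for strict inequalities. -/
theorem exists_graph_of_pos {F : EuclideanSpace ℝ (Fin n) × ℝ → ℝ} (hF : ContDiff ℝ 1 F)
    (hne : ∃ z, F z = 0) (hpos : ∀ z, F z = 0 → 0 < fderiv ℝ F z (0, 1))
    (hsl : ∀ z, F z = 0 → ∀ e, |fderiv ℝ F z (e, 0)| ≤ ‖e‖ * |fderiv ℝ F z (0, 1)|) :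
    ∃ φ : EuclideanSpace ℝ (Fin n) → ℝ, (∀ x y, |φ x - φ y| ≤ 2 * ‖x - y‖) ∧
      ∀ x t, F (x, t) = 0 ↔ t = φ x := by
  have hd : Differentiable ℝ F := hF.differentiable (by norm_num)
  have huniq : ∀ x a b, F (x, a) = 0 → F (x, b) = 0 → a = b := by
    intro x a b ha hb
    refine unique_zero_of_deriv_pos (g := fun t => F (x, t))
      (g' := fun t => fderiv ℝ F (x, t) (0, 1)) (fun t => ?_) (fun t ht => hpos _ ht) ha hb
    exact (hd (x, t)).hasFDerivAt.comp_hasDerivAt t ((hasDerivAt_const t x).prodMk (hasDerivAt_id t))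
  -- Along (e, ±2‖e‖) the derivative of F has a strict sign, so F changes sign between t - 2‖e‖r and
  -- t + 2‖e‖r, and the intermediate value theorem gives a zero.
  have hstep : ∀ x t, F (x, t) = 0 → ∀ e : EuclideanSpace ℝ (Fin n), e ≠ 0 →
      ∀ᶠ r in 𝓝[>] (0 : ℝ), ∃ s, |s - t| ≤ 2 * ‖e‖ * r ∧ F (x + r • e, s) = 0 := by
    intro x t h0 e he
    have hen : 0 < ‖e‖ := norm_pos_iff.2 he
    have hder : ∀ c : ℝ, HasDerivAt (fun r : ℝ => F (x + r • e, t + r * c))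
        (fderiv ℝ F (x, t) (e, 0) + c * fderiv ℝ F (x, t) (0, 1)) 0 := by
      intro c
      have h1 : HasDerivAt (fun r : ℝ => (x + r • e, t + r * c)) (e, c) 0 := by
        have ha : HasDerivAt (fun r : ℝ => x + r • e) e 0 := by
          simpa using ((hasDerivAt_id (0 : ℝ)).smul_const e).const_add x
        have hb : HasDerivAt (fun r : ℝ => t + r * c) c 0 := by
          simpa using ((hasDerivAt_id (0 : ℝ)).mul_const c).const_add t
        exact ha.prodMk hb
      have hd' : HasFDerivAt F (fderiv ℝ F (x, t)) ((fun r : ℝ => (x + r • e, t + r * c)) 0) := by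
        simpa using (hd (x, t)).hasFDerivAt
      have h2 := hd'.comp_hasDerivAt (0 : ℝ) h1
      refine h2.congr_deriv ?_
      have : ((e, c) : EuclideanSpace ℝ (Fin n) × ℝ) = (e, 0) + c • (0, 1) := by simp
      rw [this, map_add, map_smul, smul_eq_mul]
    have hb := abs_le.1 (hsl _ h0 e)
    have hp := hpos _ h0
    rw [abs_of_pos hp] at hb
    have hbig : ‖e‖ * fderiv ℝ F (x, t) (0, 1) > 0 := mul_pos hen hp
    have hsl1 := (hasDerivAt_iff_tendsto_slope.1 (hder (2 * ‖e‖))).mono_left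
      (nhdsWithin_mono 0 (fun s (hs : 0 < s) => hs.ne'))
    have hsl2 := (hasDerivAt_iff_tendsto_slope.1 (hder (-(2 * ‖e‖)))).mono_left
      (nhdsWithin_mono 0 (fun s (hs : 0 < s) => hs.ne'))
    filter_upwards [hsl1.eventually_const_lt (u := 0) (by nlinarith),
      hsl2.eventually_lt_const (u := 0) (by nlinarith), self_mem_nhdsWithin] with r h1 h2 hr
    have hr' : (0 : ℝ) < r := hr
    simp only [slope_def_field, zero_smul, add_zero, zero_mul, sub_zero, h0] at h1 h2
    have h1' : 0 < F (x + r • e, t + r * (2 * ‖e‖)) := by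
      by_contra hc
      exact absurd h1 (not_lt.2 (div_nonpos_of_nonpos_of_nonneg (not_lt.1 hc) hr'.le))
    have h2' : F (x + r • e, t + r * (-(2 * ‖e‖))) < 0 := by
      by_contra hc
      exact absurd h2 (not_lt.2 (div_nonneg (not_lt.1 hc) hr'.le))
    have hab : t + r * (-(2 * ‖e‖)) ≤ t + r * (2 * ‖e‖) := by nlinarith
    have hcont : ContinuousOn (fun s => F (x + r • e, s))
        (Icc (t + r * (-(2 * ‖e‖))) (t + r * (2 * ‖e‖))) :=
      (hF.continuous.comp (by fun_prop)).continuousOn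
    obtain ⟨s, hs, hs0⟩ := intermediate_value_Icc hab hcont ⟨h2'.le, h1'.le⟩
    exact ⟨s, abs_le.2 ⟨by nlinarith [hs.1], by nlinarith [hs.2]⟩, hs0⟩
  have hext : ∀ x t, F (x, t) = 0 → ∀ y, ∃ s, |s - t| ≤ 2 * ‖y - x‖ ∧ F (y, s) = 0 := by
    intro x t h0 y
    by_cases hxy : y = x
    · exact ⟨t, by simp [hxy], by rw [hxy, h0]⟩
    set e := y - x with he
    have hene : e ≠ 0 := sub_ne_zero.2 hxy
    -- Continuous induction on the segment from x to y. The set of reached parameters is closed,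
    -- being the projection of a compact set, and `hstep` extends it beyond any of its points r < 1.
    let A : Set ℝ := {r | ∃ s, |s - t| ≤ 2 * ‖e‖ * r ∧ F (x + r • e, s) = 0}
    have hAcl : IsClosed (A ∩ Icc 0 1) := by
      let K : Set (ℝ × ℝ) := {q | q.1 ∈ Icc (0 : ℝ) 1 ∧ |q.2 - t| ≤ 2 * ‖e‖ * q.1
        ∧ F (x + q.1 • e, q.2) = 0}
      have hKc : IsClosed K := by
        have c1 : IsClosed {q : ℝ × ℝ | q.1 ∈ Icc (0 : ℝ) 1} := isClosed_Icc.preimage continuous_fst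
        have c2 : IsClosed {q : ℝ × ℝ | |q.2 - t| ≤ 2 * ‖e‖ * q.1} :=
          isClosed_le (by fun_prop) (by fun_prop)
        have c3 : IsClosed {q : ℝ × ℝ | F (x + q.1 • e, q.2) = 0} :=
          isClosed_eq (hF.continuous.comp (by fun_prop)) continuous_const
        exact c1.inter (c2.inter c3)
      have hKb : K ⊆ Icc (0 : ℝ) 1 ×ˢ Icc (t - 2 * ‖e‖) (t + 2 * ‖e‖) := by
        rintro ⟨r, s⟩ ⟨hr, hs, -⟩
        have hs' := abs_le.1 hs
        have : 2 * ‖e‖ * r ≤ 2 * ‖e‖ := mul_le_of_le_one_right (by positivity) hr.2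
        exact ⟨hr, by simp only at hs' ⊢; constructor <;> linarith [hs'.1, hs'.2]⟩
      have hKcomp : IsCompact K := (isCompact_Icc.prod isCompact_Icc).of_isClosed_subset hKc hKb
      have : A ∩ Icc 0 1 = Prod.fst '' K := by
        ext r
        constructor
        · rintro ⟨⟨s, hs, hs0⟩, hr⟩
          exact ⟨(r, s), ⟨hr, hs, hs0⟩, rfl⟩
        · rintro ⟨⟨r, s⟩, ⟨hr, hs, hs0⟩, rfl⟩
          exact ⟨⟨s, hs, hs0⟩, hr⟩
      rw [this]
      exact (hKcomp.image continuous_fst).isClosed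
    have h1 : (1 : ℝ) ∈ A := by
      refine hAcl.mem_of_ge_of_forall_exists_gt ⟨t, by simp, by simpa using h0⟩ zero_le_one ?_
      rintro r ⟨⟨s, hs, hs0⟩, hr0, hr1⟩
      obtain ⟨q, ⟨s', hs', hs0'⟩, hq⟩ := ((hstep _ _ hs0 e hene).and
        (Ioc_mem_nhdsGT (sub_pos.2 hr1))).exists
      refine ⟨r + q, ⟨s', ?_, ?_⟩, ⟨by linarith [hq.1], by linarith [hq.2]⟩⟩
      · calc |s' - t| ≤ |s' - s| + |s - t| := abs_sub_le _ _ _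
          _ ≤ 2 * ‖e‖ * q + 2 * ‖e‖ * r := add_le_add hs' hs
          _ = _ := by ring
      · rw [← hs0', add_smul, add_assoc]
    obtain ⟨s, hs, hs0⟩ := h1
    refine ⟨s, by simpa using hs, ?_⟩
    rw [← hs0, one_smul, he]
    simp
  obtain ⟨⟨x0, t0⟩, h0⟩ := hne
  have hall : ∀ y, ∃ s, F (y, s) = 0 := fun y => (hext x0 t0 h0 y).imp fun s hs => hs.2
  choose φ hφ using hall
  refine ⟨φ, fun x y => ?_, fun x t => ⟨fun h => huniq x _ _ h (hφ x), fun h => h ▸ hφ x⟩⟩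
  obtain ⟨s, hs, hs0⟩ := hext y (φ y) (hφ y) x
  rwa [huniq x _ _ (hφ x) hs0]

/-- A space-like surface is the graph of a Lipschitz function defined on all of `ℝⁿ`. -/
theorem IsSpaceLike.exists_graph {S : Set (EuclideanSpace ℝ (Fin n) × ℝ)} (hS : IsSpaceLike S) :
    ∃ φ : EuclideanSpace ℝ (Fin n) → ℝ, (∀ x y, |φ x - φ y| ≤ 2 * ‖x - y‖) ∧
      ∀ x t, (x, t) ∈ S ↔ t = φ x := by
  obtain ⟨⟨hne, hconn⟩, F, hF, rfl, hgrad, hsl⟩ := hS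
  have hb : ∀ z, F z = 0 → ∀ e, |fderiv ℝ F z (e, 0)| ≤ ‖e‖ * |fderiv ℝ F z (0, 1)| :=
    fun z hz => fderiv_single_bound (hsl z hz)
  have hnz : ∀ z, F z = 0 → fderiv ℝ F z (0, 1) ≠ 0 := by
    intro z hz h0
    apply hgrad z hz
    ext w
    · have := hb z hz w
      rw [h0, abs_zero, mul_zero] at this
      simpa using abs_nonpos_iff.1 this
    · simpa using h0
  have hc : Continuous fun z => fderiv ℝ F z (0, 1) :=
    (hF.continuous_fderiv (by norm_num)).clm_apply continuous_const
  -- The time derivative of F is continuous and nonzero on the connected surface, so it cannot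
  -- change sign.
  have hsign : (∀ z, F z = 0 → 0 < fderiv ℝ F z (0, 1)) ∨
      (∀ z, F z = 0 → fderiv ℝ F z (0, 1) < 0) := by
    by_contra! hcon
    obtain ⟨⟨a, ha, ha'⟩, ⟨b, hb, hb'⟩⟩ := hcon
    obtain ⟨z, hz, hz'⟩ := hconn.intermediate_value ha hb hc.continuousOn ⟨ha', hb'⟩
    exact hnz z hz hz'
  rcases hsign with h | h
  · exact exists_graph_of_pos hF hne h hb
  · have hneg : ∀ z w, fderiv ℝ (fun z => -F z) z w = -fderiv ℝ F z w := by
      intro z w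
      rw [fderiv_fun_neg]
      rfl
    have := exists_graph_of_pos (F := fun z => -F z) hF.neg (hne.imp fun z hz => by simpa using hz)
      (fun z hz => by rw [hneg]; exact neg_pos.2 (h z (by simpa using hz)))
      (fun z hz e => by rw [hneg, hneg, abs_neg, abs_neg]; exact hb z (by simpa using hz) e)
    simpa using this

end Graph

/-! ### Cubic B-splines: a C² refinable partition of unity. -/

section Spline

open Set Filter Topology

theorem hasDerivAt_max_zero_pow (k : ℕ) (x : ℝ) :
    HasDerivAt (fun x : ℝ => (max x 0) ^ (k + 2)) ((k + 2) * (max x 0) ^ (k + 1)) x := by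
  rcases lt_trichotomy x 0 with h | h | h
  · have h0 : (fun x : ℝ => (max x 0) ^ (k + 2)) =ᶠ[𝓝 x] fun _ => 0 := by
      filter_upwards [gt_mem_nhds h] with y hy
      simp [max_eq_right hy.le]
    rw [max_eq_right h.le]
    simpa using (hasDerivAt_const x (0 : ℝ)).congr_of_eventuallyEq h0
  · subst h
    rw [hasDerivAt_iff_isLittleO]
    have h1 : (fun y : ℝ => y ^ (k + 2)) =o[𝓝 0] fun y => y ^ 1 :=
      Asymptotics.isLittleO_pow_pow (by omega)
    refine Asymptotics.IsBigO.trans_isLittleO (Asymptotics.IsBigO.of_bound 1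
      (Eventually.of_forall fun y => ?_)) (by simpa using h1)
    have : |max y 0| ≤ |y| := by
      rcases le_total y 0 with hy | hy <;> simp [hy]
    simpa [abs_pow] using pow_le_pow_left₀ (abs_nonneg _) this (k + 2)
  · have h0 : (fun x : ℝ => (max x 0) ^ (k + 2)) =ᶠ[𝓝 x] fun x => x ^ (k + 2) := by
      filter_upwards [lt_mem_nhds h] with y hy
      simp [max_eq_left hy.le]
    rw [max_eq_left h.le]
    refine HasDerivAt.congr_of_eventuallyEq ?_ h0
    simpa using hasDerivAt_pow (k + 2) x

theorem contDiff_max_zero_cube : ContDiff ℝ 2 fun x : ℝ => (max x 0) ^ 3 := by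
  have h3 : deriv (fun x : ℝ => (max x 0) ^ 3) = fun x => 3 * (max x 0) ^ 2 := by
    funext x
    rw [(hasDerivAt_max_zero_pow 1 x).deriv]
    norm_num
  have h2 : deriv (fun x : ℝ => (max x 0) ^ 2) = fun x => 2 * (max x 0) := by
    funext x
    rw [(hasDerivAt_max_zero_pow 0 x).deriv]
    norm_num
  have c1 : ContDiff ℝ 1 fun x : ℝ => (max x 0) ^ 2 := by
    rw [contDiff_one_iff_deriv, h2]
    exact ⟨fun x => (hasDerivAt_max_zero_pow 0 x).differentiableAt, by fun_prop⟩
  rw [show (2 : WithTop ℕ∞) = 1 + 1 by norm_num, contDiff_succ_iff_deriv, h3]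
  exact ⟨fun x => (hasDerivAt_max_zero_pow 1 x).differentiableAt, by simp,
    contDiff_const.mul c1⟩

/-- A cubic spline step: `0` on `(-∞, 0]` and `1` on `[3, ∞)`. -/
def splineStep (x : ℝ) : ℝ :=
  ((max x 0) ^ 3 - 3 * (max (x - 1) 0) ^ 3 + 3 * (max (x - 2) 0) ^ 3 - (max (x - 3) 0) ^ 3) / 6

/-- The cubic cardinal B-spline, supported in `[0, 4]`. -/
def bspline (x : ℝ) : ℝ := splineStep x - splineStep (x - 1)

theorem splineStep_of_nonpos {x : ℝ} (hx : x ≤ 0) : splineStep x = 0 := by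
  simp only [splineStep]
  rw [max_eq_right hx, max_eq_right (by linarith), max_eq_right (by linarith),
    max_eq_right (by linarith)]
  norm_num

theorem splineStep_of_three_le {x : ℝ} (hx : 3 ≤ x) : splineStep x = 1 := by
  simp only [splineStep]
  rw [max_eq_left (by linarith), max_eq_left (by linarith), max_eq_left (by linarith),
    max_eq_left (by linarith)]
  ring

theorem contDiff_bspline : ContDiff ℝ 2 bspline := by
  have h : ∀ c : ℝ, ContDiff ℝ 2 fun x : ℝ => (max (x - c) 0) ^ 3 := fun c =>
    contDiff_max_zero_cube.comp (contDiff_id.sub contDiff_const)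
  have hs : ContDiff ℝ 2 splineStep :=
    (((contDiff_max_zero_cube.sub (contDiff_const.mul (h 1))).add
      (contDiff_const.mul (h 2))).sub (h 3)).div_const _
  exact hs.sub (hs.comp (contDiff_id.sub contDiff_const))

theorem mem_Icc_of_bspline_ne_zero {x : ℝ} (hx : bspline x ≠ 0) : x ∈ Icc (0 : ℝ) 4 := by
  constructor
  · by_contra h
    apply hx
    rw [bspline, splineStep_of_nonpos (by linarith), splineStep_of_nonpos (by linarith), sub_zero]
  · by_contra h
    apply hx
    rw [bspline, splineStep_of_three_le (by linarith), splineStep_of_three_le (by linarith),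
      sub_self]

/-- The sum telescopes to `splineStep (x + N + 3) - splineStep (x - N)`, which is 1 - 0 when |x| ≤
N; this explains the shift and the number of terms. -/
theorem sum_bspline {x : ℝ} {N : ℕ} (hx : |x| ≤ N) :
    ∑ m ∈ Finset.range (2 * N + 3), bspline (x - ((m : ℝ) - N - 3)) = 1 := by
  have h := abs_le.1 hx
  have : ∀ m ∈ Finset.range (2 * N + 3), bspline (x - ((m : ℝ) - N - 3))
      = splineStep (x + N + 3 - m) - splineStep (x + N + 3 - (m + 1 : ℕ)) := by
    intro m _
    rw [bspline]
    push_cast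
    ring_nf
  rw [Finset.sum_congr rfl this, Finset.sum_range_sub' (fun m : ℕ => splineStep (x + N + 3 - m)),
    splineStep_of_three_le (by push_cast; linarith),
    splineStep_of_nonpos (by push_cast; linarith), sub_zero]

/-- Coefficients of the two-scale relation of the cubic B-spline. -/
def splineCoeff (j : Fin 5) : ℝ := (Nat.choose 4 j : ℝ) / 8

theorem splineCoeff_nonneg (j : Fin 5) : 0 ≤ splineCoeff j := by
  unfold splineCoeff; positivity

theorem sum_splineCoeff : ∑ j, splineCoeff j = 2 := by
  simp [splineCoeff, Fin.sum_univ_five, Nat.choose]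
  norm_num

/-- The spline is a fourth difference of x₊³ / 6. The cube is homogeneous of degree 3, and with E
the shift by 1/2 one has (1 - E²)⁴ = (1 + E)⁴ (1 - E)⁴; the binomial coefficients come from (1 + E)⁴
and the factor 1/8 from scaling. -/
theorem bspline_refine (x : ℝ) :
    bspline x = ∑ j : Fin 5, splineCoeff j * bspline (2 * x - (j : ℕ)) := by
  have h : ∀ y : ℝ, (max (2 * y) 0) ^ 3 = 8 * (max y 0) ^ 3 := by
    intro y
    rw [show max (2 * y) 0 = 2 * max y 0 by
      rw [mul_max_of_nonneg _ _ (by norm_num : (0 : ℝ) ≤ 2), mul_zero]]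
    ring
  have e0 := h x
  have e1 := h (x - 1)
  have e2 := h (x - 2)
  have e3 := h (x - 3)
  have e4 := h (x - 4)
  simp only [Fin.sum_univ_five, splineCoeff, bspline, splineStep]
  simp only [Fin.val_zero, Fin.val_one, Fin.val_two, Nat.choose, Nat.cast_zero, Nat.cast_one,
    show ((3 : Fin 5) : ℕ) = 3 from rfl, show ((4 : Fin 5) : ℕ) = 4 from rfl]
  push_cast
  ring_nf at e0 e1 e2 e3 e4 ⊢
  linarith

variable {n : ℕ}

/-- Tensor product of cubic B-splines on `ℝⁿ`. -/
def tensorSpline (x : EuclideanSpace ℝ (Fin n)) : ℝ := ∏ i, bspline (x i)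

theorem contDiff_tensorSpline : ContDiff ℝ 2 (tensorSpline (n := n)) := by
  unfold tensorSpline
  refine contDiff_prod fun i _ => contDiff_bspline.comp ?_
  exact (EuclideanSpace.proj i : EuclideanSpace ℝ (Fin n) →L[ℝ] ℝ).contDiff

theorem norm_le_of_coord {x : EuclideanSpace ℝ (Fin n)} (h : ∀ i, |x i| ≤ 4) : ‖x‖ ≤ 4 * n := by
  refine le_of_sq_le_sq ?_ (by positivity)
  rw [EuclideanSpace.norm_sq_eq]
  calc ∑ i, ‖x i‖ ^ 2 ≤ ∑ _i : Fin n, (4 : ℝ) ^ 2 :=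
        Finset.sum_le_sum fun i _ => pow_le_pow_left₀ (norm_nonneg _) (h i) 2
    _ = 16 * (n : ℝ) := by simp; ring
    _ ≤ (4 * n) ^ 2 := by
        rcases Nat.eq_zero_or_pos n with h0 | h0
        · simp [h0]
        · have : (1 : ℝ) ≤ n := by exact_mod_cast h0
          nlinarith

theorem norm_le_of_tensorSpline_ne_zero {x : EuclideanSpace ℝ (Fin n)} (hx : tensorSpline x ≠ 0) :
    ‖x‖ ≤ 4 * n := by
  refine norm_le_of_coord fun i => ?_
  have := mem_Icc_of_bspline_ne_zero (Finset.prod_ne_zero_iff.1 hx i (Finset.mem_univ i))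
  rw [abs_of_nonneg this.1]
  exact this.2

theorem tensorSpline_refine (x : EuclideanSpace ℝ (Fin n)) :
    tensorSpline x = ∑ j : Fin n → Fin 5, (∏ i, splineCoeff (j i)) *
      tensorSpline ((2 : ℝ) • x - WithLp.toLp 2 fun i => ((j i : ℕ) : ℝ)) := by
  unfold tensorSpline
  rw [Finset.prod_congr rfl fun i _ => bspline_refine (x i), Finset.prod_univ_sum,
    Fintype.piFinset_univ]
  refine Finset.sum_congr rfl fun j _ => ?_
  rw [Finset.prod_mul_distrib]
  simp

/-- The total weight 2^n of the children equals the volume ratio of cubes at consecutive scales.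
This makes the subdivision argument lose exactly 2^(-n) per step. -/
theorem sum_prod_splineCoeff : ∑ j : Fin n → Fin 5, ∏ i, splineCoeff (j i) = 2 ^ n := by
  have := Finset.prod_univ_sum (fun _ : Fin n => (Finset.univ : Finset (Fin 5)))
    (fun _ j => splineCoeff j)
  rw [Fintype.piFinset_univ] at this
  rw [← this]
  simp [sum_splineCoeff]

theorem sum_tensorSpline {x : EuclideanSpace ℝ (Fin n)} {N : ℕ} (hx : ‖x‖ ≤ N) :
    ∑ m ∈ Fintype.piFinset fun _ : Fin n => Finset.range (2 * N + 3),
      tensorSpline (x - WithLp.toLp 2 fun i => ((m i : ℝ) - N - 3)) = 1 := by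
  unfold tensorSpline
  have h1 : ∀ i, |x i| ≤ N := fun i => (PiLp.norm_apply_le x i).trans hx
  have := Finset.prod_univ_sum (fun _ : Fin n => Finset.range (2 * N + 3))
    (fun i m => bspline (x i - ((m : ℝ) - N - 3)))
  simp only [PiLp.sub_apply]
  rw [← this]
  exact Finset.prod_eq_one fun i _ => sum_bspline (h1 i)

end Spline

/-! ### Cutting a flat weak solution off along the graph. -/

section Gluing

open Set Filter Topology Metric

variable {n : ℕ}

/-- The pairing of `u` with `epd v` over the region above the graph of `φ`. -/
def epigraphPairing (u : EuclideanSpace ℝ (Fin n) × ℝ → ℝ) (φ : EuclideanSpace ℝ (Fin n) → ℝ)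
    (v : EuclideanSpace ℝ (Fin n) × ℝ → ℝ) : ℝ :=
  ∫ z in {z : EuclideanSpace ℝ (Fin n) × ℝ | φ z.1 < z.2}, u z * epd v z

/-- The tensor spline at scale `2 ^ (-k)` with offset `m`, as a function on space-time. -/
def scaledSpline (k : ℕ) (m : EuclideanSpace ℝ (Fin n)) (z : EuclideanSpace ℝ (Fin n) × ℝ) : ℝ :=
  tensorSpline ((2 : ℝ) ^ k • z.1 - m)

theorem contDiff_scaledSpline (k : ℕ) (m : EuclideanSpace ℝ (Fin n)) :
    ContDiff ℝ 2 (scaledSpline k m) :=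
  contDiff_tensorSpline.comp (by fun_prop)

/-- The point of `ℝⁿ` marked by the offset `j`. -/
def offset (j : Fin n → Fin 5) : EuclideanSpace ℝ (Fin n) :=
  WithLp.toLp 2 fun i => ((j i : ℕ) : ℝ)

theorem scaledSpline_refine (k : ℕ) (m : EuclideanSpace ℝ (Fin n))
    (z : EuclideanSpace ℝ (Fin n) × ℝ) :
    scaledSpline k m z = ∑ j : Fin n → Fin 5, (∏ i, splineCoeff (j i)) *
      scaledSpline (k + 1) ((2 : ℝ) • m + offset j) z := by
  rw [scaledSpline, tensorSpline_refine]
  refine Finset.sum_congr rfl fun j _ => ?_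
  rw [scaledSpline, offset, smul_sub, smul_smul, pow_succ', sub_sub]

theorem norm_offset_le (j : Fin n → Fin 5) : ‖offset j‖ ≤ 4 * n := by
  refine norm_le_of_coord fun i => ?_
  have : (j i : ℕ) ≤ 4 := by omega
  simp only [offset, Nat.abs_cast]
  exact_mod_cast this

section Pairing

variable {u : EuclideanSpace ℝ (Fin n) × ℝ → ℝ} {φ : EuclideanSpace ℝ (Fin n) → ℝ}
  {v w : EuclideanSpace ℝ (Fin n) × ℝ → ℝ}

theorem isOpen_epigraph (hφ : Continuous φ) :
    IsOpen {z : EuclideanSpace ℝ (Fin n) × ℝ | φ z.1 < z.2} :=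
  isOpen_lt (hφ.comp continuous_fst) continuous_snd

theorem IsTest.integrable_mul_epd (hu : Continuous u) (hv : IsTest v) :
    Integrable fun z => u z * epd v z :=
  (hu.mul hv.continuous_epd).integrable_of_hasCompactSupport hv.hasCompactSupport_epd.mul_left

theorem epigraphPairing_sum {ι : Type*} (hu : Continuous u) (s : Finset ι) (c : ι → ℝ)
    {v : ι → EuclideanSpace ℝ (Fin n) × ℝ → ℝ} (hv : ∀ i ∈ s, IsTest (v i)) :
    epigraphPairing u φ (fun z => ∑ i ∈ s, c i * v i z)
      = ∑ i ∈ s, c i * epigraphPairing u φ (v i) := by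
  simp only [epigraphPairing]
  have h : ∀ z, u z * epd (fun z => ∑ i ∈ s, c i * v i z) z
      = ∑ i ∈ s, c i * (u z * epd (v i) z) := by
    intro z
    rw [IsTest.epd_sum s (fun i hi => (hv i hi).const_mul (c i)), Finset.mul_sum]
    refine Finset.sum_congr rfl fun i hi => ?_
    rw [(hv i hi).epd_const_mul]
    ring
  simp_rw [h]
  rw [integral_finsetSum]
  · exact Finset.sum_congr rfl fun i _ => integral_const_mul _ _
  · exact fun i hi => (((hv i hi).integrable_mul_epd hu).const_mul (c i)).integrableOn

theorem epigraphPairing_add (hu : Continuous u) (hv : IsTest v) (hw : IsTest w) :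
    epigraphPairing u φ (fun z => v z + w z) = epigraphPairing u φ v + epigraphPairing u φ w := by
  simp only [epigraphPairing]
  rw [← integral_add (hv.integrable_mul_epd hu).integrableOn (hw.integrable_mul_epd hu).integrableOn]
  congr 1
  funext z
  rw [hv.epd_add hw]
  ring

theorem epigraphPairing_congr (hφ : Continuous φ) (h : ∀ z, φ z.1 < z.2 → v z = w z) :
    epigraphPairing u φ v = epigraphPairing u φ w := by
  refine setIntegral_congr_fun (isOpen_epigraph hφ).measurableSet fun z hz => ?_
  have : v =ᶠ[𝓝 z] w := by
    filter_upwards [(isOpen_epigraph hφ).mem_nhds hz] with y hy using h y hy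
  simp only [epd_congr this]

theorem epigraphPairing_eq_zero_of_tsupport
    (hweak : ∫ z, u z * epd v z = 0) (h : ∀ z ∈ tsupport v, φ z.1 < z.2) :
    epigraphPairing u φ v = 0 := by
  rw [epigraphPairing, setIntegral_eq_integral_of_forall_compl_eq_zero, hweak]
  intro z hz
  rw [epd_eq_zero_of_notMem_tsupport fun hz' => hz (h z hz'), mul_zero]

end Pairing

/-- A smooth step which vanishes on `(-∞, C]` and equals `1` on `[2 C, ∞)`. -/
def stepAt (C τ : ℝ) : ℝ := Real.smoothTransition ((τ - C) / C)

theorem contDiff_stepAt (C : ℝ) : ContDiff ℝ 2 (stepAt C) :=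
  Real.smoothTransition.contDiff.comp (by fun_prop)

theorem stepAt_of_le {C τ : ℝ} (hC : 0 < C) (h : τ ≤ C) : stepAt C τ = 0 :=
  Real.smoothTransition.zero_of_nonpos (div_nonpos_of_nonpos_of_nonneg (by linarith) hC.le)

theorem stepAt_of_ge {C τ : ℝ} (hC : 0 < C) (h : 2 * C ≤ τ) : stepAt C τ = 1 :=
  Real.smoothTransition.one_of_one_le ((one_le_div hC).2 (by linarith))

/-- A cutoff on space-time built from a tensor spline and a bump in time. -/
def spaceTimeCutoff (C : ℝ) (z : EuclideanSpace ℝ (Fin n) × ℝ) : ℝ :=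
  tensorSpline z.1 * ((1 - stepAt C z.2) * (1 - stepAt C (-z.2)))

theorem contDiff_spaceTimeCutoff (C : ℝ) : ContDiff ℝ 2 (spaceTimeCutoff (n := n) C) := by
  refine (contDiff_tensorSpline.comp contDiff_fst).mul (ContDiff.mul ?_ ?_)
  · exact contDiff_const.sub ((contDiff_stepAt C).comp contDiff_snd)
  · exact contDiff_const.sub ((contDiff_stepAt C).comp contDiff_snd.neg)

theorem bounds_of_spaceTimeCutoff_ne_zero {C : ℝ} (hC : 0 < C)
    {z : EuclideanSpace ℝ (Fin n) × ℝ} (hz : spaceTimeCutoff C z ≠ 0) :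
    ‖z.1‖ ≤ 4 * n ∧ |z.2| ≤ 2 * C := by
  refine ⟨norm_le_of_tensorSpline_ne_zero (left_ne_zero_of_mul hz), abs_le.2 ⟨?_, ?_⟩⟩
  · by_contra h
    refine right_ne_zero_of_mul (right_ne_zero_of_mul hz) ?_
    rw [stepAt_of_ge hC (by linarith), sub_self]
  · by_contra h
    refine left_ne_zero_of_mul (right_ne_zero_of_mul hz) ?_
    rw [stepAt_of_ge hC (by linarith), sub_self]

theorem hasCompactSupport_spaceTimeCutoff {C : ℝ} (hC : 0 < C) :
    HasCompactSupport (spaceTimeCutoff (n := n) C) := by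
  refine HasCompactSupport.intro
    ((isCompact_closedBall (0 : EuclideanSpace ℝ (Fin n)) (4 * n)).prod
      (isCompact_closedBall (0 : ℝ) (2 * C))) fun z hz => ?_
  by_contra h
  have := bounds_of_spaceTimeCutoff_ne_zero hC h
  exact hz ⟨by simpa using this.1, by simpa using this.2⟩

/-- The pairing over the epigraph against a localized test function only sees a small piece
of the region near the graph. -/
theorem epigraphPairing_localize {u : EuclideanSpace ℝ (Fin n) × ℝ → ℝ} (hu : Continuous u)
    (hweak : ∀ v, IsTest v → ∫ z, u z * epd v z = 0) {φ : EuclideanSpace ℝ (Fin n) → ℝ}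
    (hφ : ∀ x y, |φ x - φ y| ≤ 2 * ‖x - y‖) (hφc : Continuous φ)
    {v : EuclideanSpace ℝ (Fin n) × ℝ → ℝ} (hv : IsTest v) {k : ℕ}
    {m x₀ : EuclideanSpace ℝ (Fin n)} (hx₀ : ‖(2 : ℝ) ^ k • x₀ - m‖ ≤ 4 * n) :
    epigraphPairing u φ (fun z => v z * scaledSpline k m z)
      = epigraphPairing u φ (fun z => v z * spaceTimeCutoff (16 * n + 1 : ℝ)
          ((2 : ℝ) ^ k • z + (-m, -((2 : ℝ) ^ k * φ x₀)))) := by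
  -- On the support of the spline, 2^k φ varies from 2^k φ(x₀) by at most 2 · (4n + 4n) = 16n. The
  -- extra 1 puts the support of the upper piece strictly above the graph.
  set C : ℝ := 16 * n + 1 with hC
  have hC0 : 0 < C := by positivity
  set a : ℝ := (2 : ℝ) ^ k with ha
  have ha0 : 0 < a := by positivity
  have hdist : ∀ z : EuclideanSpace ℝ (Fin n) × ℝ, ‖a • z.1 - m‖ ≤ 4 * n →
      |a * φ z.1 - a * φ x₀| ≤ 16 * n := by
    intro z hz
    rw [← mul_sub, abs_mul, abs_of_pos ha0]
    calc a * |φ z.1 - φ x₀| ≤ a * (2 * ‖z.1 - x₀‖) := by gcongr; exact hφ _ _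
      _ = 2 * ‖(a • z.1 - m) - (a • x₀ - m)‖ := by
        rw [sub_sub_sub_cancel_right, ← smul_sub, norm_smul, Real.norm_eq_abs, abs_of_pos ha0]
        ring
      _ ≤ 2 * (4 * n + 4 * n) := by
        gcongr
        exact (norm_sub_le _ _).trans (add_le_add hz hx₀)
      _ = 16 * n := by ring
  let σ : EuclideanSpace ℝ (Fin n) × ℝ → ℝ := fun z => stepAt C (a * z.2 - a * φ x₀)
  have hσ : ContDiff ℝ 2 σ := (contDiff_stepAt C).comp (by fun_prop)
  have hζ := hv.mul_right (contDiff_scaledSpline k m)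
  have hup := hζ.mul_right hσ
  have hlow := hζ.mul_right (contDiff_const.sub hσ : ContDiff ℝ 2 fun z => 1 - σ z)
  have hsplit : (fun z => v z * scaledSpline k m z)
      = fun z => v z * scaledSpline k m z * σ z + v z * scaledSpline k m z * (1 - σ z) := by
    funext z; ring
  -- The upper piece is a test function supported in the open epigraph, so the weak equation alone
  -- kills its pairing.
  have h0 : epigraphPairing u φ (fun z => v z * scaledSpline k m z * σ z) = 0 := by
    refine epigraphPairing_eq_zero_of_tsupport (hweak _ hup) ?_
    have hsub : tsupport (fun z => v z * scaledSpline k m z * σ z) ⊆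
        {z | ‖a • z.1 - m‖ ≤ 4 * n ∧ C ≤ a * z.2 - a * φ x₀} := by
      refine closure_minimal (fun z hz => ⟨?_, ?_⟩) ?_
      · exact norm_le_of_tensorSpline_ne_zero (right_ne_zero_of_mul (left_ne_zero_of_mul hz))
      · by_contra h
        exact right_ne_zero_of_mul hz (stepAt_of_le hC0 (not_le.1 h).le)
      · have c1 : IsClosed {z : EuclideanSpace ℝ (Fin n) × ℝ | ‖a • z.1 - m‖ ≤ 4 * n} :=
          isClosed_le (by fun_prop) (by fun_prop)
        have c2 : IsClosed {z : EuclideanSpace ℝ (Fin n) × ℝ | C ≤ a * z.2 - a * φ x₀} :=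
          isClosed_le (by fun_prop) (by fun_prop)
        exact c1.inter c2
    intro z hz
    obtain ⟨h1, h2⟩ := hsub hz
    have h3 := (abs_le.1 (hdist z h1)).2
    have : a * φ z.1 < a * z.2 := by linarith
    exact lt_of_mul_lt_mul_left this ha0.le
  rw [hsplit, epigraphPairing_add hu hup hlow, h0, zero_add]
  -- Only values above the graph matter, and there the lower time cutoff in `spaceTimeCutoff` equals
  -- 1 wherever the spline is nonzero.
  refine epigraphPairing_congr hφc fun z hz => ?_
  have hsp : scaledSpline k m z = tensorSpline (a • z.1 - m) := rfl
  by_cases hzero : tensorSpline (a • z.1 - m) = 0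
  · simp [spaceTimeCutoff, hsp, hzero, ← sub_eq_add_neg]
  · have h1 := hdist z (norm_le_of_tensorSpline_ne_zero hzero)
    have h3 := (abs_le.1 h1).1
    have h4 : a * φ z.1 < a * z.2 := mul_lt_mul_of_pos_left hz ha0
    have h5 : stepAt C (-(a * z.2 - a * φ x₀)) = 0 := stepAt_of_le hC0 (by linarith)
    simp only [spaceTimeCutoff, σ, hsp, Prod.smul_fst, Prod.fst_add, Prod.snd_add, Prod.smul_snd,
      ← sub_eq_add_neg, smul_eq_mul, h5]
    ring

/-- Flatness of `u` along the graph gives decay of the localized pairings, faster than the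
volume of the supporting cubes. -/
theorem exists_abs_epigraphPairing_lt {u : EuclideanSpace ℝ (Fin n) × ℝ → ℝ} (hu : Continuous u)
    (hweak : ∀ v, IsTest v → ∫ z, u z * epd v z = 0) {φ : EuclideanSpace ℝ (Fin n) → ℝ}
    (hφ : ∀ x y, |φ x - φ y| ≤ 2 * ‖x - y‖) (hφc : Continuous φ)
    {v : EuclideanSpace ℝ (Fin n) × ℝ → ℝ} (hv : IsTest v) {x₀ : EuclideanSpace ℝ (Fin n)}
    (hflat : u =o[𝓝 (x₀, φ x₀)] fun z => z - (x₀, φ x₀))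
    {m : ℕ → EuclideanSpace ℝ (Fin n)} (hm : ∀ k, ‖(2 : ℝ) ^ k • x₀ - m k‖ ≤ 4 * n)
    {A : ℝ} (hA : 0 < A) :
    ∃ k, |epigraphPairing u φ (fun z => v z * scaledSpline k (m k) z)| < A / ((2 : ℝ) ^ k) ^ n := by
  set C : ℝ := 16 * n + 1 with hC
  have hC0 : 0 < C := by positivity
  obtain ⟨B, hB⟩ := hv.exists_epd_mul_scale_bound (contDiff_spaceTimeCutoff (n := n) C)
    (hasCompactSupport_spaceTimeCutoff hC0)
  have hB0 : 0 ≤ B := by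
    have := (abs_nonneg _).trans (hB 1 le_rfl 0 0)
    simpa using this
  set V : ℝ := (volume : Measure (EuclideanSpace ℝ (Fin n) × ℝ)).real (closedBall 0 1) with hV
  have hV0 : 0 ≤ V := measureReal_nonneg
  set M : ℝ := 2 * C with hM
  have hM0 : 0 < M := by positivity
  set D : ℝ := M * B * (M ^ (n + 1) * V) with hD
  have hD0 : 0 ≤ D := by positivity
  -- D collects all scale-independent constants of the final estimate. Dividing by D + 1 gives
  -- strict inequality and covers D = 0.
  have hε : 0 < A / (D + 1) := by positivity
  obtain ⟨r, hr, hru⟩ := Metric.eventually_nhds_iff_ball.1 (hflat.def hε)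
  obtain ⟨k, hk⟩ : ∃ k : ℕ, M / (2 : ℝ) ^ k < r := by
    have h1 : Tendsto (fun k : ℕ => M / (2 : ℝ) ^ k) atTop (𝓝 0) :=
      tendsto_const_nhds.div_atTop (tendsto_pow_atTop_atTop_of_one_lt (by norm_num))
    exact (h1.eventually_lt_const hr).exists
  refine ⟨k, ?_⟩
  rw [epigraphPairing_localize hu hweak hφ hφc hv (hm k)]
  set a : ℝ := (2 : ℝ) ^ k with ha
  have ha1 : 1 ≤ a := one_le_pow₀ (by norm_num)
  have ha0 : 0 < a := by linarith
  set c : EuclideanSpace ℝ (Fin n) × ℝ := (-m k, -(a * φ x₀)) with hc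
  set g : EuclideanSpace ℝ (Fin n) × ℝ → ℝ := fun z => v z * spaceTimeCutoff C (a • z + c) with hg
  have hsupp : ∀ z, epd g z ≠ 0 → z ∈ closedBall (x₀, φ x₀) (M / a) := by
    have hts : tsupport g ⊆ closedBall (x₀, φ x₀) (M / a) := by
      refine closure_minimal (fun z hz => ?_) isClosed_closedBall
      obtain ⟨h1, h2⟩ := bounds_of_spaceTimeCutoff_ne_zero hC0 (right_ne_zero_of_mul hz)
      simp only [hc, Prod.smul_fst, Prod.fst_add, Prod.snd_add, Prod.smul_snd,
        ← sub_eq_add_neg, smul_eq_mul] at h1 h2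
      rw [mem_closedBall, dist_eq_norm, Prod.norm_def]
      refine max_le ?_ ?_
      · rw [le_div_iff₀ ha0]
        calc ‖z.1 - x₀‖ * a = ‖(a • z.1 - m k) - (a • x₀ - m k)‖ := by
              rw [sub_sub_sub_cancel_right, ← smul_sub, norm_smul, Real.norm_eq_abs,
                abs_of_pos ha0, mul_comm]
          _ ≤ 4 * n + 4 * n := (norm_sub_le _ _).trans (add_le_add h1 (hm k))
          _ ≤ M := by
              have : (0 : ℝ) ≤ n := Nat.cast_nonneg n
              linarith
      · rw [le_div_iff₀ ha0]
        calc ‖z.2 - φ x₀‖ * a = |a * z.2 - a * φ x₀| := by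
              rw [← mul_sub, abs_mul, abs_of_pos ha0, mul_comm, Real.norm_eq_abs]
          _ ≤ M := h2
    intro z hz
    by_contra h
    exact hz (epd_eq_zero_of_notMem_tsupport fun h' => h (hts h'))
  have hbd : ∀ z ∈ closedBall (x₀, φ x₀) (M / a), ‖u z * epd g z‖ ≤ A / (D + 1) * (M / a) * (B * a ^ 2) := by
    intro z hz
    rw [norm_mul]
    have h1 := hru z (closedBall_subset_ball hk hz)
    rw [mem_closedBall, dist_eq_norm] at hz
    refine mul_le_mul (h1.trans ?_) (hB a ha1 c z) (norm_nonneg _) (by positivity)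
    gcongr
  have hmeas : MeasurableSet {z : EuclideanSpace ℝ (Fin n) × ℝ | φ z.1 < z.2} :=
    (isOpen_epigraph hφc).measurableSet
  have hrestr : epigraphPairing u φ g
      = ∫ z in {z | φ z.1 < z.2} ∩ closedBall (x₀, φ x₀) (M / a), u z * epd g z := by
    refine setIntegral_eq_of_subset_of_forall_sdiff_eq_zero hmeas inter_subset_left ?_
    intro z hz
    by_contra h
    exact hz.2 ⟨hz.1, hsupp z (right_ne_zero_of_mul h)⟩
  have hball : volume.real (closedBall ((x₀, φ x₀) : EuclideanSpace ℝ (Fin n) × ℝ) (M / a))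
      = (M / a) ^ (n + 1) * V := by
    have hH : (volume : Measure (EuclideanSpace ℝ (Fin n) × ℝ)).IsAddHaarMeasure := by
      rw [Measure.volume_eq_prod]
      infer_instance
    rw [Measure.addHaar_real_closedBall' _ _ (by positivity)]
    congr 2
    rw [Module.finrank_prod, finrank_euclideanSpace_fin, Module.finrank_self]
  have hfin : volume ({z : EuclideanSpace ℝ (Fin n) × ℝ | φ z.1 < z.2} ∩
      closedBall (x₀, φ x₀) (M / a)) < ⊤ :=
    (measure_mono inter_subset_right).trans_lt measure_closedBall_lt_top
  rw [hrestr]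
  calc |∫ z in {z | φ z.1 < z.2} ∩ closedBall (x₀, φ x₀) (M / a), u z * epd g z|
      ≤ A / (D + 1) * (M / a) * (B * a ^ 2) *
        volume.real ({z : EuclideanSpace ℝ (Fin n) × ℝ | φ z.1 < z.2} ∩
          closedBall (x₀, φ x₀) (M / a)) :=
        norm_setIntegral_le_of_norm_le_const hfin fun z hz => hbd z hz.2
    _ ≤ A / (D + 1) * (M / a) * (B * a ^ 2) * ((M / a) ^ (n + 1) * V) := by
        rw [← hball]
        refine mul_le_mul_of_nonneg_left ?_ (by positivity)
        exact measureReal_mono inter_subset_right measure_closedBall_lt_top.ne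
    -- The powers of a balance as a⁻¹ from flatness, a² from `epd`, and a^(-(n+1)) from the volume.
    _ = A * (D / (D + 1)) / a ^ n := by
        rw [hD, div_pow]
        field_simp
        ring
    _ < A / a ^ n := by
        refine div_lt_div_of_pos_right ?_ (by positivity)
        exact mul_lt_of_lt_one_right hA ((div_lt_one (by linarith)).2 (by linarith))

/-- A continuous weak solution which is flat (in the pointwise sense) along the graph of a Lipschitz
function can be cut off to zero below the graph. -/
theorem epigraphPairing_eq_zero {u : EuclideanSpace ℝ (Fin n) × ℝ → ℝ} (hu : Continuous u)
    (hweak : ∀ v, IsTest v → ∫ z, u z * epd v z = 0) {φ : EuclideanSpace ℝ (Fin n) → ℝ}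
    (hφ : ∀ x y, |φ x - φ y| ≤ 2 * ‖x - y‖) (hφc : Continuous φ)
    (hflat : ∀ x, u =o[𝓝 (x, φ x)] fun z => z - (x, φ x))
    {v : EuclideanSpace ℝ (Fin n) × ℝ → ℝ} (hv : IsTest v) : epigraphPairing u φ v = 0 := by
  have htest : ∀ k m, IsTest fun z => v z * scaledSpline k m z := fun k m =>
    hv.mul_right (contDiff_scaledSpline k m)
  have hstart : ∃ s : Finset (Fin n → ℕ), ∃ o : (Fin n → ℕ) → EuclideanSpace ℝ (Fin n),
      v = fun z => ∑ j ∈ s, 1 * (v z * scaledSpline 0 (o j) z) := by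
    obtain ⟨R, hR⟩ := hv.compact.isCompact.isBounded.subset_closedBall 0
    obtain ⟨N, hN⟩ := exists_nat_ge R
    refine ⟨Fintype.piFinset fun _ : Fin n => Finset.range (2 * N + 3),
      fun m => WithLp.toLp 2 fun i => ((m i : ℝ) - N - 3), ?_⟩
    funext z
    simp only [one_mul, ← Finset.mul_sum]
    by_cases hz : v z = 0
    · simp [hz]
    · have h1 := hR (subset_tsupport _ hz)
      rw [mem_closedBall_zero_iff] at h1
      have h2 : ‖z.1‖ ≤ N := (norm_fst_le z).trans (h1.trans hN)
      have := sum_tensorSpline h2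
      simp only [scaledSpline, pow_zero, one_smul, this, mul_one]
  by_contra hne
  obtain ⟨m₀, hm₀⟩ : ∃ m, epigraphPairing u φ (fun z => v z * scaledSpline 0 m z) ≠ 0 := by
    by_contra! hall
    obtain ⟨s, o, hso⟩ := hstart
    apply hne
    rw [hso, epigraphPairing_sum hu s (fun _ => 1) fun j _ => htest 0 (o j)]
    simp [hall]
  set A := |epigraphPairing u φ (fun z => v z * scaledSpline 0 m₀ z)| with hA
  have hA0 : 0 < A := abs_pos.2 hm₀
  -- Pigeonhole: if all children were below A / 2^((k+1)n), their weighted sum, of total weight 2^n,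
  -- would be below A / 2^(kn).
  have hstep : ∀ (k : ℕ) (m : EuclideanSpace ℝ (Fin n)),
      A / ((2 : ℝ) ^ k) ^ n ≤ |epigraphPairing u φ (fun z => v z * scaledSpline k m z)| →
      ∃ j : Fin n → Fin 5, A / ((2 : ℝ) ^ (k + 1)) ^ n ≤
        |epigraphPairing u φ (fun z => v z * scaledSpline (k + 1) ((2 : ℝ) • m + offset j) z)| := by
    intro k m hkm
    by_contra! hlt
    have hexp : (fun z => v z * scaledSpline k m z) = fun z => ∑ j : Fin n → Fin 5,
        (∏ i, splineCoeff (j i)) * (v z * scaledSpline (k + 1) ((2 : ℝ) • m + offset j) z) := by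
      funext z
      rw [scaledSpline_refine, Finset.mul_sum]
      exact Finset.sum_congr rfl fun j _ => by ring
    rw [hexp, epigraphPairing_sum hu _ _ fun j _ => htest _ _] at hkm
    have hcp : ∀ j : Fin n → Fin 5, 0 ≤ ∏ i, splineCoeff (j i) := fun j =>
      Finset.prod_nonneg fun i _ => splineCoeff_nonneg _
    have hcpos : ∀ j : Fin n → Fin 5, 0 < ∏ i, splineCoeff (j i) := fun j =>
      Finset.prod_pos fun i _ => by
        have : 0 < Nat.choose 4 (j i) := Nat.choose_pos (by omega)
        unfold splineCoeff
        positivity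
    have : |∑ j : Fin n → Fin 5, (∏ i, splineCoeff (j i)) * epigraphPairing u φ
        (fun z => v z * scaledSpline (k + 1) ((2 : ℝ) • m + offset j) z)|
        < A / ((2 : ℝ) ^ k) ^ n := by
      calc _ ≤ ∑ j : Fin n → Fin 5, (∏ i, splineCoeff (j i)) * |epigraphPairing u φ
            (fun z => v z * scaledSpline (k + 1) ((2 : ℝ) • m + offset j) z)| := by
            refine (Finset.abs_sum_le_sum_abs _ _).trans (Finset.sum_le_sum fun j _ => ?_)
            rw [abs_mul, abs_of_nonneg (hcp j)]
        _ < ∑ j : Fin n → Fin 5, (∏ i, splineCoeff (j i)) * (A / ((2 : ℝ) ^ (k + 1)) ^ n) :=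
            Finset.sum_lt_sum_of_nonempty Finset.univ_nonempty fun j _ =>
              mul_lt_mul_of_pos_left (hlt j) (hcpos j)
        _ = A / ((2 : ℝ) ^ k) ^ n := by
            rw [← Finset.sum_mul, sum_prod_splineCoeff, pow_succ, mul_pow]
            field_simp
    linarith
  choose! J hJ using hstep
  let m : ℕ → EuclideanSpace ℝ (Fin n) := fun k =>
    Nat.rec m₀ (fun k m => (2 : ℝ) • m + offset (J k m)) k
  have hmlow : ∀ k, A / ((2 : ℝ) ^ k) ^ n
      ≤ |epigraphPairing u φ (fun z => v z * scaledSpline k (m k) z)| := by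
    intro k
    induction k with
    | zero => simp [m, hA]
    | succ k ih => exact hJ k (m k) ih
  -- The rescaled offsets locate the chosen splines. Successive ones differ by at most 4n / 2^(k+1),
  -- so they converge, and the limit x₀ stays within 4n / 2^k of the k-th.
  let x : ℕ → EuclideanSpace ℝ (Fin n) := fun k => ((2 : ℝ) ^ k)⁻¹ • m k
  have hxd : ∀ k, dist (x k) (x (k + 1)) ≤ 4 * n / 2 / 2 ^ k := by
    intro k
    have : x k - x (k + 1) = -(((2 : ℝ) ^ (k + 1))⁻¹ • offset (J k (m k))) := by
      simp only [x]
      have h1 : m (k + 1) = (2 : ℝ) • m k + offset (J k (m k)) := rfl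
      rw [h1, smul_add, smul_smul, pow_succ]
      have h2 : ((2 : ℝ) ^ k * 2)⁻¹ * 2 = ((2 : ℝ) ^ k)⁻¹ := by field_simp
      rw [h2]
      abel
    rw [dist_eq_norm, this, norm_neg, norm_smul, norm_inv, norm_pow, Real.norm_two]
    calc ((2 : ℝ) ^ (k + 1))⁻¹ * ‖offset (J k (m k))‖ ≤ ((2 : ℝ) ^ (k + 1))⁻¹ * (4 * n) := by
          gcongr
          exact norm_offset_le _
      _ = 4 * n / 2 / 2 ^ k := by
          rw [pow_succ]
          field_simp
  obtain ⟨x₀, hx₀⟩ := cauchySeq_tendsto_of_complete (cauchySeq_of_le_geometric_two hxd)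
  have hm : ∀ k, ‖(2 : ℝ) ^ k • x₀ - m k‖ ≤ 4 * n := by
    intro k
    have h1 := dist_le_of_le_geometric_two_of_tendsto hxd hx₀ k
    have h2 : (2 : ℝ) ^ k • x₀ - m k = (2 : ℝ) ^ k • (x₀ - x k) := by
      simp only [x]
      rw [smul_sub, smul_smul, mul_inv_cancel₀ (by positivity), one_smul]
    rw [h2, norm_smul, norm_pow, Real.norm_two, ← dist_eq_norm, dist_comm]
    rw [le_div_iff₀ (by positivity)] at h1
    linarith
  obtain ⟨k, hk⟩ := exists_abs_epigraphPairing_lt hu hweak hφ hφc hv (hflat x₀) hm hA0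
  exact absurd hk (not_lt.2 (hmlow k))

end Gluing

/-! ### Mollification in the space variable. -/

section Mollification

open Set Filter Topology Metric
open scoped ContDiff Convolution

variable {n : ℕ}

/-- Mollification in the space variable only. -/
def moll (q : EuclideanSpace ℝ (Fin n) × ℝ → ℝ) (ψ : EuclideanSpace ℝ (Fin n) → ℝ)
    (z : EuclideanSpace ℝ (Fin n) × ℝ) : ℝ :=
  ∫ y, q (y, z.2) * ψ (z.1 - y)

variable {q : EuclideanSpace ℝ (Fin n) × ℝ → ℝ} {ψ : EuclideanSpace ℝ (Fin n) → ℝ}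

theorem continuous_moll (hq : Continuous q) (hψ : Continuous ψ) (hs : HasCompactSupport ψ) :
    Continuous (moll q ψ) := by
  have h1 : moll q ψ = fun z => ∫ y in tsupport ψ, q (z.1 - y, z.2) * ψ y := by
    funext z
    rw [setIntegral_eq_integral_of_forall_compl_eq_zero fun y hy => by
      rw [image_eq_zero_of_notMem_tsupport hy, mul_zero]]
    rw [moll, ← integral_sub_left_eq_self _ _ z.1]
    simp
  rw [h1]
  exact continuous_parametric_integral_of_continuous
    (f := fun (z : EuclideanSpace ℝ (Fin n) × ℝ) y => q (z.1 - y, z.2) * ψ y)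
    (by fun_prop) hs.isCompact

theorem integrable_moll (hq : Continuous q) (hψ : Continuous ψ) (hs : HasCompactSupport ψ)
    (z : EuclideanSpace ℝ (Fin n) × ℝ) : Integrable fun y => q (y, z.2) * ψ (z.1 - y) := by
  refine Continuous.integrable_of_hasCompactSupport (by fun_prop) (HasCompactSupport.mul_left ?_)
  exact hs.comp_homeomorph (Homeomorph.subLeft z.1)

theorem hasLineDerivAt_moll_space (hq : Continuous q) (hψ : ContDiff ℝ 1 ψ)
    (hs : HasCompactSupport ψ) (e : EuclideanSpace ℝ (Fin n))
    (z : EuclideanSpace ℝ (Fin n) × ℝ) :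
    HasLineDerivAt ℝ (moll q ψ) (moll q (dirD e ψ) z) z (e, 0) := by
  have hl : LocallyIntegrable (fun y => q (y, z.2)) volume :=
    (hq.comp (by fun_prop)).locallyIntegrable
  have h1 := hs.hasFDerivAt_convolution_right (ContinuousLinearMap.mul ℝ ℝ) hl hψ z.1
  have h2 := h1.hasLineDerivAt e
  rw [convolution_precompR_apply (ContinuousLinearMap.mul ℝ ℝ) hl (hs.fderiv ℝ)
    (hψ.continuous_fderiv (by norm_num))] at h2
  have h3 : HasDerivAt (fun s : ℝ => moll q ψ (z + s • (e, (0 : ℝ)))) (moll q (dirD e ψ) z) 0 := by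
    refine HasDerivAt.congr_deriv (HasDerivAt.congr_of_eventuallyEq h2
      (Eventually.of_forall fun s => ?_)) ?_
    · simp [moll, convolution_def]
    · simp [moll, convolution_def, dirD]
  exact h3

theorem hasDerivAt_moll_time {q' : EuclideanSpace ℝ (Fin n) × ℝ → ℝ} (hq : Continuous q)
    (hq' : Continuous q') (hd : ∀ y t, HasDerivAt (fun t => q (y, t)) (q' (y, t)) t)
    (hψ : Continuous ψ) (hs : HasCompactSupport ψ) (x : EuclideanSpace ℝ (Fin n)) (t : ℝ) :
    HasDerivAt (fun t => moll q ψ (x, t)) (moll q' ψ (x, t)) t := by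
  have hsx : HasCompactSupport fun y => ψ (x - y) := hs.comp_homeomorph (Homeomorph.subLeft x)
  obtain ⟨C, hC⟩ := ((hsx.isCompact.prod (isCompact_closedBall t 1)).exists_bound_of_continuousOn
    hq'.continuousOn)
  refine (hasDerivAt_integral_of_dominated_loc_of_deriv_le
    (F := fun t y => q (y, t) * ψ (x - y)) (F' := fun t y => q' (y, t) * ψ (x - y))
    (bound := fun y => C * |ψ (x - y)|) (ball_mem_nhds t one_pos) ?_ ?_ ?_ ?_ ?_ ?_).2
  · exact Eventually.of_forall fun s => Continuous.aestronglyMeasurable (by fun_prop)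
  · exact integrable_moll hq hψ hs (x, t)
  · exact Continuous.aestronglyMeasurable (by fun_prop)
  · refine Eventually.of_forall fun y s hy => ?_
    by_cases h : y ∈ tsupport fun y => ψ (x - y)
    · rw [norm_mul]
      exact mul_le_mul_of_nonneg_right (hC (y, s) ⟨h, ball_subset_closedBall hy⟩) (norm_nonneg _)
    · have : ψ (x - y) = 0 := image_eq_zero_of_notMem_tsupport (f := fun y => ψ (x - y)) h
      simp [this]
  · refine Continuous.integrable_of_hasCompactSupport (by fun_prop) (HasCompactSupport.mul_left ?_)
    exact hsx.norm
  · exact Eventually.of_forall fun y s _ => (hd y s).mul_const _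

theorem moll_sum {ι : Type*} (s : Finset ι) {ψ : ι → EuclideanSpace ℝ (Fin n) → ℝ}
    (hq : Continuous q) (hψ : ∀ i ∈ s, Continuous (ψ i)) (hs : ∀ i ∈ s, HasCompactSupport (ψ i))
    (z : EuclideanSpace ℝ (Fin n) × ℝ) :
    moll q (fun x => ∑ i ∈ s, ψ i x) z = ∑ i ∈ s, moll q (ψ i) z := by
  simp only [moll, Finset.mul_sum]
  exact integral_finsetSum _ fun i hi => integrable_moll hq (hψ i hi) (hs i hi) z

/-- Near a given z, the mollification sees q only over a compact set of y, where φ is bounded below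
by a positive number; hence it vanishes around every z with z.2 ≤ 0. -/
theorem tsupport_moll_pos {φ : EuclideanSpace ℝ (Fin n) → ℝ} (hφc : Continuous φ)
    (hφ : ∀ x, 0 < φ x) (hq0 : ∀ x t, t ≤ φ x → q (x, t) = 0) (hs : HasCompactSupport ψ) :
    ∀ z ∈ tsupport (moll q ψ), 0 < z.2 := by
  obtain ⟨R, hR⟩ := hs.isCompact.isBounded.subset_closedBall 0
  intro z hz
  by_contra hneg
  obtain ⟨y₀, -, hy₀⟩ := (isCompact_closedBall z.1 (|R| + 1)).exists_isMinOn
    ⟨z.1, mem_closedBall_self (by positivity)⟩ hφc.continuousOn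
  refine notMem_tsupport_iff_eventuallyEq.2 ?_ hz
  have h1 : ∀ᶠ w in 𝓝 z, w.1 ∈ ball z.1 1 :=
    continuous_fst.continuousAt.eventually (ball_mem_nhds _ one_pos)
  have h2 : ∀ᶠ w in 𝓝 z, w.2 < φ y₀ :=
    continuous_snd.continuousAt.eventually (gt_mem_nhds ((not_lt.1 hneg).trans_lt (hφ y₀)))
  filter_upwards [h1, h2] with w hw1 hw2
  refine integral_eq_zero_of_ae (Eventually.of_forall fun y => ?_)
  by_cases hy : ψ (w.1 - y) = 0
  · simp [hy]
  · have h3 := hR (subset_tsupport _ hy)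
    rw [mem_closedBall_zero_iff] at h3
    have h4 : y ∈ closedBall z.1 (|R| + 1) := by
      rw [mem_closedBall, dist_eq_norm]
      calc ‖y - z.1‖ = ‖(w.1 - z.1) - (w.1 - y)‖ := by congr 1; abel
        _ ≤ ‖w.1 - z.1‖ + ‖w.1 - y‖ := norm_sub_le _ _
        _ ≤ 1 + |R| := add_le_add (by rw [← dist_eq_norm]; exact (mem_ball.1 hw1).le)
            (h3.trans (le_abs_self R))
        _ = |R| + 1 := add_comm _ _
    have h5 : w.2 ≤ φ y := hw2.le.trans (hy₀ h4)
    simp [hq0 y w.2 h5]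

theorem continuous_inv_pow_mul {g : EuclideanSpace ℝ (Fin n) × ℝ → ℝ} (N : ℕ) (hg : Continuous g)
    (hpos : ∀ z ∈ tsupport g, 0 < z.2) : Continuous fun z => (z.2 ^ N)⁻¹ * g z := by
  rw [continuous_iff_continuousAt]
  intro z
  by_cases hz : z ∈ tsupport g
  · exact ((continuous_snd.pow N).continuousAt.inv₀ (pow_ne_zero _ (hpos z hz).ne')).mul
      hg.continuousAt
  · have h0 : g =ᶠ[𝓝 z] 0 := notMem_tsupport_iff_eventuallyEq.1 hz
    have : (fun z => (z.2 ^ N)⁻¹ * g z) =ᶠ[𝓝 z] fun _ => 0 := by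
      filter_upwards [h0] with y hy
      simp [hy]
    exact continuousAt_const.congr this.symm

end Mollification

/-! ### Regularity for the weak radial ordinary differential equation. -/

section RadialODE

open Set Filter Topology

/-- Regularity of weak solutions of `(t ^ N * W')' = t ^ N * H` which vanish near `t = 0`. -/
theorem hasDerivAt_of_weak_radial {N : ℕ} {W H P : ℝ → ℝ} {c : ℝ} (hc : 0 < c)
    (hW : Continuous W) (hH : Continuous H) (hW0 : ∀ t ≤ c, W t = 0) (hH0 : ∀ t ≤ c, H t = 0)
    (hP0 : ∀ t ≤ c, P t = 0) (hP : ∀ t, HasDerivAt P (t ^ N * H t) t)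
    (hweak : ∀ a : ℝ → ℝ, ContDiff ℝ 2 a → HasCompactSupport a → (∀ t ∈ tsupport a, 0 < t) →
      ∫ t, t ^ N * (W t * (deriv (deriv a) t + N * (deriv a t / t)) - H t * a t) = 0) (t : ℝ) :
    HasDerivAt W ((t ^ N)⁻¹ * P t) t := by
  have hPc : Continuous P := continuous_iff_continuousAt.2 fun t => (hP t).continuousAt
  let g : ℝ → ℝ := fun s => (s ^ N)⁻¹ * P s
  have hg : Continuous g := by
    rw [continuous_iff_continuousAt]
    intro s
    by_cases hs : s < c
    · have : g =ᶠ[𝓝 s] fun _ => 0 := by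
        filter_upwards [gt_mem_nhds hs] with r hr
        simp [g, hP0 r hr.le]
      exact continuousAt_const.congr this.symm
    · exact ((continuous_pow N).continuousAt.inv₀ (pow_ne_zero _ (by linarith))).mul
        hPc.continuousAt
  -- Z is the classical solution with zero initial data. The weak equation for W is tested by
  -- duality to show W = Z.
  let Z : ℝ → ℝ := fun t => ∫ s in (0 : ℝ)..t, g s
  have hZ : ∀ t, HasDerivAt Z (g t) t := fun t =>
    intervalIntegral.integral_hasDerivAt_right (hg.intervalIntegrable _ _)
      (hg.stronglyMeasurableAtFilter _ _) hg.continuousAt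
  have hZc : Continuous Z := continuous_iff_continuousAt.2 fun t => (hZ t).continuousAt
  have hZ0 : ∀ t ≤ c, Z t = 0 := by
    intro t ht
    refine intervalIntegral.integral_zero_ae (Eventually.of_forall fun s hs => ?_)
    have : s ≤ c := by
      rcases le_total 0 t with h | h
      · rw [uIoc_of_le h] at hs; exact hs.2.trans ht
      · rw [uIoc_of_ge h] at hs; exact hs.2.trans hc.le
    simp [g, hP0 s this]
  suffices hWZ : ∀ t, W t = Z t by
    rw [show W = Z from funext hWZ]
    exact hZ t
  by_contra! hne
  obtain ⟨t₀, ht₀⟩ := hne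
  have ht₀c : c < t₀ := by
    by_contra h
    exact ht₀ (by rw [hW0 _ (not_lt.1 h), hZ0 _ (not_lt.1 h)])
  let B : ℝ := t₀ + 1
  have hB : 0 < B := by simp only [B]; linarith
  -- The test function a will satisfy (t^N a')' = t^N b for t > c, so that pairing with W - Z gives
  -- ∫ t^N (W - Z)² max(B - t, 0) = 0. Two integrations from B downwards make a vanish beyond B, and
  -- a continuous b suffices for a to be C².
  let b : ℝ → ℝ := fun t => (W t - Z t) * max (B - t) 0
  have hb : Continuous b := (hW.sub hZc).mul (by fun_prop)
  have hbB : ∀ t, B ≤ t → b t = 0 := fun t ht => by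
    simp only [b]
    rw [max_eq_right (by linarith), mul_zero]
  let β : ℝ → ℝ := fun t => ∫ r in t..B, r ^ N * b r
  have hrb : Continuous fun r : ℝ => r ^ N * b r := by fun_prop
  have hβ : ∀ t, HasDerivAt β (-(t ^ N * b t)) t := fun t =>
    intervalIntegral.integral_hasDerivAt_left (hrb.intervalIntegrable _ _)
      (hrb.stronglyMeasurableAtFilter _ _) hrb.continuousAt
  have hβB : ∀ t, B ≤ t → β t = 0 := by
    intro t ht
    refine intervalIntegral.integral_zero_ae (Eventually.of_forall fun s hs => ?_)
    rw [uIoc_of_ge ht] at hs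
    rw [hbB s hs.1.le, mul_zero]
  have hβ1 : ContDiff ℝ 1 β := by
    rw [contDiff_one_iff_deriv, show deriv β = fun t => -(t ^ N * b t) from
      funext fun t => (hβ t).deriv]
    exact ⟨fun t => (hβ t).differentiableAt, hrb.neg⟩
  -- The cutoff differs from 1 only for t < c/2, where W and H already vanish. Below, `m` is a
  -- positive C² substitute for t that agrees with it from c/2 on, so dividing by m^N creates no
  -- singularity.
  let η : ℝ → ℝ := fun t => Real.smoothTransition ((t - c / 4) / (c / 4))
  have hη : ContDiff ℝ 2 η := Real.smoothTransition.contDiff.comp (by fun_prop)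
  have hη0 : ∀ t ≤ c / 4, η t = 0 := fun t ht =>
    Real.smoothTransition.zero_of_nonpos (div_nonpos_of_nonpos_of_nonneg (by linarith)
      (by linarith))
  have hη1 : ∀ t, c / 2 ≤ t → η t = 1 := fun t ht =>
    Real.smoothTransition.one_of_one_le ((one_le_div (by linarith)).2 (by linarith))
  let m : ℝ → ℝ := fun t => t * η t + (1 - η t)
  have hm : ContDiff ℝ 2 m := (contDiff_id.mul hη).add (contDiff_const.sub hη)
  have hmpos : ∀ t, 0 < m t := by
    intro t
    have h0 : 0 ≤ η t := Real.smoothTransition.nonneg _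
    have h1 : η t ≤ 1 := Real.smoothTransition.le_one _
    simp only [m]
    rcases le_or_gt t (c / 4) with h | h
    · rw [hη0 t h]; norm_num
    · have ht : 0 < t := by linarith
      rcases h0.eq_or_lt with h' | h'
      · rw [← h']; norm_num
      · nlinarith [mul_pos ht h']
  have hm1 : ∀ t, c / 2 ≤ t → m t = t := fun t ht => by
    simp only [m]
    rw [hη1 t ht]; ring
  let k : ℝ → ℝ := fun t => (m t ^ N)⁻¹ * β t
  have hk : ContDiff ℝ 1 k :=
    (((hm.of_le (by norm_num)).pow N).inv fun t => pow_ne_zero _ (hmpos t).ne').mul hβ1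
  let a₀ : ℝ → ℝ := fun t => ∫ s in t..B, k s
  have ha₀ : ∀ t, HasDerivAt a₀ (-k t) t := fun t =>
    intervalIntegral.integral_hasDerivAt_left (hk.continuous.intervalIntegrable _ _)
      (hk.continuous.stronglyMeasurableAtFilter _ _) hk.continuous.continuousAt
  have ha₀B : ∀ t, B ≤ t → a₀ t = 0 := by
    intro t ht
    refine intervalIntegral.integral_zero_ae (Eventually.of_forall fun s hs => ?_)
    rw [uIoc_of_ge ht] at hs
    simp only [k]
    rw [hβB s hs.1.le, mul_zero]
  have ha₀2 : ContDiff ℝ 2 a₀ := by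
    rw [show (2 : WithTop ℕ∞) = 1 + 1 by norm_num, contDiff_succ_iff_deriv,
      show deriv a₀ = fun t => -k t from funext fun t => (ha₀ t).deriv]
    exact ⟨fun t => (ha₀ t).differentiableAt, by simp, hk.neg⟩
  let a : ℝ → ℝ := fun t => η t * a₀ t
  have hats : tsupport a ⊆ Icc (c / 4) B := by
    refine closure_minimal (fun t ht => ⟨?_, ?_⟩) isClosed_Icc
    · by_contra h
      exact left_ne_zero_of_mul ht (hη0 t (not_le.1 h).le)
    · by_contra h
      exact right_ne_zero_of_mul ht (ha₀B t (not_le.1 h).le)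
  have hw := hweak a (hη.mul ha₀2)
    (isCompact_Icc.of_isClosed_subset (isClosed_tsupport _) hats)
    (fun t ht => by linarith [(hats ht).1])
  have hda : ∀ t, c / 2 < t → deriv a t = -((t ^ N)⁻¹ * β t) := by
    intro t ht
    have h1 : a =ᶠ[𝓝 t] a₀ := by
      filter_upwards [lt_mem_nhds ht] with r hr
      simp only [a]
      rw [hη1 r hr.le, one_mul]
    rw [h1.deriv_eq, (ha₀ t).deriv]
    simp only [k]
    rw [hm1 t ht.le]
  have hdda : ∀ t, c < t → deriv (deriv a) t + N * (deriv a t / t) = b t := by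
    intro t ht
    have ht0 : t ≠ 0 := by linarith
    have h1 : deriv a =ᶠ[𝓝 t] fun t => -((t ^ N)⁻¹ * β t) := by
      filter_upwards [lt_mem_nhds (show c / 2 < t by linarith)] with r hr using hda r hr
    have h2 : HasDerivAt (fun t : ℝ => -((t ^ N)⁻¹ * β t)) _ t :=
      (((hasDerivAt_pow N t).inv (pow_ne_zero _ ht0)).mul (hβ t)).neg
    rw [h1.deriv_eq, h2.deriv, hda t (by linarith)]
    rcases Nat.eq_zero_or_pos N with h0 | h0
    · subst h0; simp
    · obtain ⟨M, rfl⟩ : ∃ M, N = M + 1 := ⟨N - 1, by omega⟩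
      simp only [Nat.add_sub_cancel, Pi.inv_apply]
      field_simp
      ring
  let F₁ : ℝ → ℝ := fun t => t ^ N * (W t * b t - H t * a₀ t)
  let F₂ : ℝ → ℝ := fun t => t ^ N * (H t * a₀ t - Z t * b t)
  have hF₁s : Function.support F₁ ⊆ Ioc 0 B := by
    intro t ht
    constructor
    · by_contra h
      have h' : t ≤ c := (not_lt.1 h).trans hc.le
      exact ht (by simp [F₁, hW0 t h', hH0 t h'])
    · by_contra h
      exact ht (by simp [F₁, hbB t (not_le.1 h).le, ha₀B t (not_le.1 h).le])
  have hF₂s : Function.support F₂ ⊆ Ioc 0 B := by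
    intro t ht
    constructor
    · by_contra h
      have h' : t ≤ c := (not_lt.1 h).trans hc.le
      exact ht (by simp [F₂, hZ0 t h', hH0 t h'])
    · by_contra h
      exact ht (by simp [F₂, hbB t (not_le.1 h).le, ha₀B t (not_le.1 h).le])
  have hF₁ : Continuous F₁ :=
    (continuous_pow N).mul ((hW.mul hb).sub (hH.mul ha₀2.continuous))
  have hF₂ : Continuous F₂ :=
    (continuous_pow N).mul ((hH.mul ha₀2.continuous).sub (hZc.mul hb))
  have hI₁ : ∫ t, F₁ t = 0 := by
    rw [← hw]
    congr 1
    funext t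
    rcases le_or_gt t c with h | h
    · simp [F₁, hW0 t h, hH0 t h]
    · simp only [F₁, a]
      rw [← hdda t h, hη1 t (by linarith), one_mul]
  -- F₂ is the derivative of Zβ + Pa₀: the terms Z'β and Pa₀' cancel. The boundary values vanish at
  -- 0 through Z and P, and at B through β and a₀.
  have hI₂ : ∫ t, F₂ t = 0 := by
    rw [← intervalIntegral.integral_eq_integral_of_support_subset hF₂s,
      intervalIntegral.integral_eq_sub_of_hasDerivAt (f := fun t => Z t * β t + P t * a₀ t)
        (fun t _ => ?_) (hF₂.intervalIntegrable _ _)]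
    · simp [hβB B le_rfl, ha₀B B le_rfl, hZ0 0 hc.le, hP0 0 hc.le]
    · refine (((hZ t).mul (hβ t)).add ((hP t).mul (ha₀ t))).congr_deriv ?_
      have : g t * β t = P t * k t := by
        simp only [g, k]
        rcases le_or_gt t c with h | h
        · simp [hP0 t h]
        · rw [hm1 t (by linarith)]; ring
      rw [this]
      simp only [F₂]
      ring
  have hcs : ∀ {F : ℝ → ℝ}, Function.support F ⊆ Ioc 0 B → HasCompactSupport F := fun h =>
    HasCompactSupport.of_support_subset_isCompact isCompact_Icc (h.trans Ioc_subset_Icc_self)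
  have hsum : ∫ t, (F₁ t + F₂ t) = 0 := by
    rw [integral_add (hF₁.integrable_of_hasCompactSupport (hcs hF₁s))
      (hF₂.integrable_of_hasCompactSupport (hcs hF₂s)), hI₁, hI₂, add_zero]
  have heq : ∀ t, F₁ t + F₂ t = t ^ N * ((W t - Z t) ^ 2 * max (B - t) 0) := by
    intro t
    simp only [F₁, F₂, b]
    ring
  refine (Continuous.integral_pos_of_hasCompactSupport_nonneg_nonzero (μ := volume)
    (f := fun t => F₁ t + F₂ t) (x := t₀) (hF₁.add hF₂) ((hcs hF₁s).add (hcs hF₂s)) ?_ ?_).ne' hsum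
  · intro t
    simp only [Pi.zero_apply, heq]
    rcases le_or_gt t c with h | h
    · simp [hW0 t h, hZ0 t h]
    · have : 0 < t := hc.trans h
      positivity
  · rw [heq]
    have h1 : 0 < t₀ := hc.trans ht₀c
    have h2 : W t₀ - Z t₀ ≠ 0 := sub_ne_zero.2 ht₀
    have h3 : max (B - t₀) 0 = 1 := by simp [B]
    rw [h3]
    positivity

end RadialODE

/-! ### Separated test functions and regularity in time. -/

section Energy

open Set Filter Topology Metric
open scoped ContDiff

variable {n : ℕ}

/-- The Laplacian of a function on `ℝⁿ`, as a sum of iterated directional derivatives. -/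
def lap (ψ : EuclideanSpace ℝ (Fin n) → ℝ) (x : EuclideanSpace ℝ (Fin n)) : ℝ :=
  ∑ i : Fin n, dirD (EuclideanSpace.single i (1 : ℝ)) (dirD (EuclideanSpace.single i (1 : ℝ)) ψ) x

/-- Smooth compactly supported functions on `ℝⁿ`. -/
structure IsBump (ψ : EuclideanSpace ℝ (Fin n) → ℝ) : Prop where
  contDiff : ContDiff ℝ ∞ ψ
  compact : HasCompactSupport ψ

namespace IsBump

variable {ψ : EuclideanSpace ℝ (Fin n) → ℝ}

theorem dirD (h : IsBump ψ) (e : EuclideanSpace ℝ (Fin n)) : IsBump (dirD e ψ) :=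
  ⟨h.contDiff.dirD (by simp), h.compact.dirD⟩

theorem tsupport_lap (ψ : EuclideanSpace ℝ (Fin n) → ℝ) : tsupport (lap ψ) ⊆ tsupport ψ := by
  refine closure_minimal (fun x hx => ?_) (isClosed_tsupport ψ)
  by_contra h
  refine hx (Finset.sum_eq_zero fun i _ => ?_)
  exact (dirD_eq_zero_of_notMem_tsupport
    fun h' => h (tsupport_dirD_subset _ _ h')).eq_of_nhds

theorem lap (h : IsBump ψ) : IsBump (lap ψ) :=
  ⟨ContDiff.sum fun _ _ => ((h.dirD _).dirD _).contDiff,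
    h.compact.mono' ((subset_tsupport _).trans (tsupport_lap ψ))⟩

theorem differentiable (h : IsBump ψ) : Differentiable ℝ ψ :=
  h.contDiff.differentiable (by simp)

theorem contDiff_of_le_two (h : IsBump ψ) {m : WithTop ℕ∞} (hm : m ≤ 2) : ContDiff ℝ m ψ :=
  h.contDiff.of_le (hm.trans (WithTop.coe_le_coe.2 (le_top : (2 : ℕ∞) ≤ ⊤)))

theorem dirD_lap (h : IsBump ψ) (e : EuclideanSpace ℝ (Fin n)) :
    _root_.dirD e (_root_.lap ψ) = _root_.lap (_root_.dirD e ψ) := by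
  funext x
  have h1 : _root_.dirD e (_root_.lap ψ) x = ∑ i : Fin n, _root_.dirD e
      (_root_.dirD (EuclideanSpace.single i (1 : ℝ))
        (_root_.dirD (EuclideanSpace.single i (1 : ℝ)) ψ)) x := by
    simp only [_root_.dirD]
    have := fderiv_fun_sum (𝕜 := ℝ) (u := Finset.univ) (x := x)
      (A := fun i : Fin n => _root_.dirD (EuclideanSpace.single i (1 : ℝ))
        (_root_.dirD (EuclideanSpace.single i (1 : ℝ)) ψ))
      (fun i _ => ((h.dirD _).dirD _).differentiable x)
    rw [show _root_.lap ψ = fun x => ∑ i : Fin n, _root_.dirD (EuclideanSpace.single i (1 : ℝ))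
        (_root_.dirD (EuclideanSpace.single i (1 : ℝ)) ψ) x from rfl, this]
    simp
  rw [h1]
  refine Finset.sum_congr rfl fun i _ => ?_
  rw [dirD_comm ((h.dirD _).contDiff_of_le_two le_rfl)]
  congr 1
  funext y
  exact dirD_comm (h.contDiff_of_le_two le_rfl) _ _ y

end IsBump

theorem dirD_reflect_mul {ψ : EuclideanSpace ℝ (Fin n) → ℝ} (hψ : Differentiable ℝ ψ)
    {a : ℝ → ℝ} (ha : Differentiable ℝ a) (x₀ : EuclideanSpace ℝ (Fin n)) (c : ℝ)
    (z e : EuclideanSpace ℝ (Fin n) × ℝ) :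
    dirD e (fun z => c * (ψ (x₀ - z.1) * a z.2)) z
      = c * (ψ (x₀ - z.1) * (deriv a z.2 * e.2) - dirD e.1 ψ (x₀ - z.1) * a z.2) := by
  have h1 : HasFDerivAt (fun z : EuclideanSpace ℝ (Fin n) × ℝ => x₀ - z.1)
      (-(ContinuousLinearMap.fst ℝ (EuclideanSpace ℝ (Fin n)) ℝ)) z :=
    (hasFDerivAt_fst (p := z)).const_sub x₀
  have h2 := (hψ (x₀ - z.1)).hasFDerivAt.comp z h1
  have h3 := (ha z.2).hasDerivAt.comp_hasFDerivAt z (hasFDerivAt_snd (𝕜 := ℝ) (p := z))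
  have h4 : HasFDerivAt (fun z : EuclideanSpace ℝ (Fin n) × ℝ => c * (ψ (x₀ - z.1) * a z.2)) _ z :=
    (h2.mul h3).const_mul c
  rw [dirD, h4.fderiv]
  simp [dirD]
  ring

theorem epd_product {ψ : EuclideanSpace ℝ (Fin n) → ℝ} (hψ : IsBump ψ) {a : ℝ → ℝ}
    (ha : ContDiff ℝ 2 a) (x₀ : EuclideanSpace ℝ (Fin n)) (z : EuclideanSpace ℝ (Fin n) × ℝ) :
    epd (fun z => ψ (x₀ - z.1) * a z.2) z
      = ψ (x₀ - z.1) * (deriv (deriv a) z.2 + (n - 1) * (deriv a z.2 / z.2))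
        - lap ψ (x₀ - z.1) * a z.2 := by
  have hda : Differentiable ℝ a := ha.differentiable (by norm_num)
  have hda' : Differentiable ℝ (deriv a) :=
    (contDiff_succ_iff_deriv (n := 1).1 (by norm_num; exact ha)).2.2.differentiable (by norm_num)
  have e1 : dirD ((0 : EuclideanSpace ℝ (Fin n)), (1 : ℝ)) (fun z => ψ (x₀ - z.1) * a z.2)
      = fun z => 1 * (ψ (x₀ - z.1) * deriv a z.2) := by
    funext w
    have := dirD_reflect_mul hψ.differentiable hda x₀ 1 w (0, 1)
    simpa [dirD] using this
  have e2 : ∀ e : EuclideanSpace ℝ (Fin n), dirD (e, (0 : ℝ)) (fun z => ψ (x₀ - z.1) * a z.2)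
      = fun z => (-1) * (dirD e ψ (x₀ - z.1) * a z.2) := by
    intro e
    funext w
    have := dirD_reflect_mul hψ.differentiable hda x₀ 1 w (e, 0)
    simpa using this
  simp only [epd, e1, e2]
  rw [dirD_reflect_mul hψ.differentiable hda']
  simp only [dirD_reflect_mul (hψ.dirD _).differentiable hda, lap, Finset.sum_mul]
  simp [dirD]
  ring

theorem isTest_product {ψ : EuclideanSpace ℝ (Fin n) → ℝ} (hψ : IsBump ψ) {a : ℝ → ℝ}
    (ha : ContDiff ℝ 2 a) (has : HasCompactSupport a) (hap : ∀ t ∈ tsupport a, 0 < t)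
    (x₀ : EuclideanSpace ℝ (Fin n)) : IsTest (fun z => ψ (x₀ - z.1) * a z.2) := by
  have hsub : tsupport (fun z : EuclideanSpace ℝ (Fin n) × ℝ => ψ (x₀ - z.1) * a z.2)
      ⊆ tsupport (fun y => ψ (x₀ - y)) ×ˢ tsupport a := by
    refine closure_minimal (fun z hz => ⟨subset_tsupport _ ?_, subset_tsupport _ ?_⟩)
      ((isClosed_tsupport _).prod (isClosed_tsupport _))
    · exact left_ne_zero_of_mul hz
    · exact right_ne_zero_of_mul hz
  refine ⟨?_, ?_, fun z hz => hap _ (hsub hz).2⟩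
  · exact ((hψ.contDiff_of_le_two le_rfl).comp (by fun_prop)).mul (ha.comp contDiff_snd)
  · exact ((hψ.compact.comp_homeomorph (Homeomorph.subLeft x₀)).isCompact.prod
      has.isCompact).of_isClosed_subset (isClosed_tsupport _) hsub

section TimeRegularity

variable {q : EuclideanSpace ℝ (Fin n) × ℝ → ℝ} {φ : EuclideanSpace ℝ (Fin n) → ℝ}

/-- The weighted primitive in time `∫₀ᵗ r ^ (n - 1) q(y, r) dr`. -/
def timePrimitive (q : EuclideanSpace ℝ (Fin n) × ℝ → ℝ) (z : EuclideanSpace ℝ (Fin n) × ℝ) : ℝ :=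
  ∫ r in (0 : ℝ)..z.2, r ^ (n - 1) * q (z.1, r)

theorem continuous_timePrimitive (hq : Continuous q) : Continuous (timePrimitive q) :=
  intervalIntegral.continuous_parametric_intervalIntegral_of_continuous
    (f := fun (z : EuclideanSpace ℝ (Fin n) × ℝ) r => r ^ (n - 1) * q (z.1, r))
    (by fun_prop) continuous_snd

theorem hasDerivAt_timePrimitive (hq : Continuous q) (y : EuclideanSpace ℝ (Fin n)) (t : ℝ) :
    HasDerivAt (fun t => timePrimitive q (y, t)) (t ^ (n - 1) * q (y, t)) t := by
  have hc : Continuous fun r : ℝ => r ^ (n - 1) * q (y, r) := by fun_prop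
  exact intervalIntegral.integral_hasDerivAt_right (hc.intervalIntegrable _ _)
    (hc.stronglyMeasurableAtFilter _ _) hc.continuousAt

theorem timePrimitive_eq_zero (hφ : ∀ x, 0 < φ x) (hq0 : ∀ x t, t ≤ φ x → q (x, t) = 0)
    (x : EuclideanSpace ℝ (Fin n)) (t : ℝ) (ht : t ≤ φ x) : timePrimitive q (x, t) = 0 := by
  refine intervalIntegral.integral_zero_ae (Eventually.of_forall fun s hs => ?_)
  have : s ≤ φ x := by
    rcases le_total 0 t with h | h
    · rw [uIoc_of_le h] at hs; exact hs.2.trans ht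
    · rw [uIoc_of_ge h] at hs; exact hs.2.trans (hφ x).le
  rw [hq0 x s this, mul_zero]

theorem moll_eq_zero (hq0 : ∀ x t, t ≤ φ x → q (x, t) = 0) {ψ : EuclideanSpace ℝ (Fin n) → ℝ}
    {x : EuclideanSpace ℝ (Fin n)} {t : ℝ} (h : ∀ y, x - y ∈ tsupport ψ → t ≤ φ y) :
    moll q ψ (x, t) = 0 := by
  refine integral_eq_zero_of_ae (Eventually.of_forall fun y => ?_)
  by_cases hy : x - y ∈ tsupport ψ
  · simp [hq0 y t (h y hy)]
  · simp [image_eq_zero_of_notMem_tsupport hy]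

theorem exists_pos_le_on_tsupport (hφc : Continuous φ) (hφ : ∀ x, 0 < φ x)
    {ψ : EuclideanSpace ℝ (Fin n) → ℝ} (hψ : HasCompactSupport ψ) (x : EuclideanSpace ℝ (Fin n)) :
    ∃ c, 0 < c ∧ ∀ y, x - y ∈ tsupport ψ → c ≤ φ y := by
  have hK : IsCompact {y | x - y ∈ tsupport ψ} :=
    (Homeomorph.subLeft x).isClosedEmbedding.isCompact_preimage hψ.isCompact
  rcases eq_empty_or_nonempty {y | x - y ∈ tsupport ψ} with h | h
  · exact ⟨1, one_pos, fun y hy => absurd (show y ∈ {y | x - y ∈ tsupport ψ} from hy) (by simp [h])⟩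
  · obtain ⟨y₀, -, hy₀⟩ := hK.exists_isMinOn h hφc.continuousOn
    exact ⟨φ y₀, hφ y₀, fun y hy => hy₀ hy⟩

/-- Testing with ψ(x - y) a(t) moves the Laplacian onto ψ and leaves, for fixed x, the weak equation
(t^(n-1) W')' = t^(n-1) H with W and H the mollifications of q by ψ and `lap ψ`. The radial
regularity result then supplies W'. -/
theorem hasDerivAt_moll_time_of_weak (hn : 1 ≤ n) (hq : Continuous q) (hφc : Continuous φ)
    (hφ : ∀ x, 0 < φ x) (hq0 : ∀ x t, t ≤ φ x → q (x, t) = 0)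
    (hweak : ∀ v, IsTest v → ∫ z, z.2 ^ (n - 1) * q z * epd v z = 0)
    {ψ : EuclideanSpace ℝ (Fin n) → ℝ} (hψ : IsBump ψ) (x : EuclideanSpace ℝ (Fin n)) (t : ℝ) :
    HasDerivAt (fun t => moll q ψ (x, t))
      ((t ^ (n - 1))⁻¹ * moll (timePrimitive q) (lap ψ) (x, t)) t := by
  obtain ⟨c, hc, hcφ⟩ := exists_pos_le_on_tsupport hφc hφ hψ.compact x
  have hcl : ∀ y, x - y ∈ tsupport (lap ψ) → c ≤ φ y := fun y hy =>
    hcφ y (IsBump.tsupport_lap ψ hy)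
  have hx : Continuous fun t : ℝ => (x, t) := by fun_prop
  have hcψ := continuous_moll hq hψ.contDiff.continuous hψ.compact
  have hcl' := continuous_moll hq hψ.lap.contDiff.continuous hψ.lap.compact
  have hN : ((n - 1 : ℕ) : ℝ) = (n : ℝ) - 1 := by push_cast [hn]; ring
  refine hasDerivAt_of_weak_radial (N := n - 1) (H := fun t => moll q (lap ψ) (x, t))
    (P := fun t => moll (timePrimitive q) (lap ψ) (x, t)) hc
    (hcψ.comp hx) (hcl'.comp hx)
    (fun t ht => moll_eq_zero hq0 fun y hy => ht.trans (hcφ y hy))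
    (fun t ht => moll_eq_zero hq0 fun y hy => ht.trans (hcl y hy))
    (fun t ht => moll_eq_zero (timePrimitive_eq_zero hφ hq0) fun y hy => ht.trans (hcl y hy))
    (fun t => ?_) (fun a ha has hap => ?_) t
  · have h1 := hasDerivAt_moll_time (continuous_timePrimitive hq)
      (q' := fun z => z.2 ^ (n - 1) * q z) (by fun_prop) (hasDerivAt_timePrimitive hq)
      hψ.lap.contDiff.continuous hψ.lap.compact x t
    refine h1.congr_deriv ?_
    simp only [moll, mul_assoc]
    exact integral_const_mul _ _
  · have hv := isTest_product hψ ha has hap x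
    have h0 := hweak _ hv
    have hint : Integrable fun z : EuclideanSpace ℝ (Fin n) × ℝ =>
        z.2 ^ (n - 1) * q z * epd (fun z => ψ (x - z.1) * a z.2) z :=
      IsTest.integrable_mul_epd (u := fun z => z.2 ^ (n - 1) * q z) (by fun_prop) hv
    rw [Measure.volume_eq_prod] at h0 hint
    rw [integral_prod_symm _ hint] at h0
    rw [← h0]
    congr 1
    funext t
    have hi1 := integrable_moll hq hψ.contDiff.continuous hψ.compact (x, t)
    have hi2 := integrable_moll hq hψ.lap.contDiff.continuous hψ.lap.compact (x, t)
    have h1 : ∀ y, t ^ (n - 1) * q (y, t) * epd (fun z => ψ (x - z.1) * a z.2) (y, t)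
        = t ^ (n - 1) * ((deriv (deriv a) t + (n - 1) * (deriv a t / t)) * (q (y, t) * ψ (x - y))
          - a t * (q (y, t) * lap ψ (x - y))) := by
      intro y
      rw [epd_product hψ ha]
      ring
    simp_rw [h1]
    rw [integral_const_mul, integral_sub (hi1.const_mul _) (hi2.const_mul _),
      integral_const_mul, integral_const_mul, hN]
    simp only [moll, Function.comp_apply]
    ring

end TimeRegularity

end Energy

/-! ### Weighted energy estimate and uniqueness. -/

section Uniqueness

open Set Filter Topology Metric
open scoped ContDiff

theorem HasLineDerivAt.mul_real {V : Type*} [AddCommGroup V] [Module ℝ V] {f g : V → ℝ}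
    {f' g' : ℝ} {x v : V} (hf : HasLineDerivAt ℝ f f' x v) (hg : HasLineDerivAt ℝ g g' x v) :
    HasLineDerivAt ℝ (fun y => f y * g y) (f' * g x + f x * g') x v := by
  have := HasDerivAt.mul hf hg
  simp only [zero_smul, add_zero] at this
  exact this

theorem HasLineDerivAt.sq_real {V : Type*} [AddCommGroup V] [Module ℝ V] {f : V → ℝ}
    {f' : ℝ} {x v : V} (hf : HasLineDerivAt ℝ f f' x v) :
    HasLineDerivAt ℝ (fun y => f y ^ 2) (2 * (f x * f')) x v := by
  have := hf.mul_real hf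
  simp only [← pow_two] at this
  exact HasDerivAt.congr_deriv this (by ring)

variable {n : ℕ}

theorem hasLineDerivAt_time {g : EuclideanSpace ℝ (Fin n) × ℝ → ℝ} {g' : ℝ}
    {z : EuclideanSpace ℝ (Fin n) × ℝ} (h : HasDerivAt (fun t => g (z.1, t)) g' z.2) :
    HasLineDerivAt ℝ g g' z (0, 1) := by
  have h1 : HasDerivAt (fun s : ℝ => g (z.1, z.2 + s)) g' 0 :=
    HasDerivAt.comp_const_add z.2 0 (by simpa using h)
  refine HasDerivAt.congr_of_eventuallyEq h1 (Eventually.of_forall fun s => ?_)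
  simp only
  congr 1
  ext <;> simp

/-- The regularized distance `√(1 + |x - p|²)`. -/
def regDist (p x : EuclideanSpace ℝ (Fin n)) : ℝ := √(1 + ‖x - p‖ ^ 2)

theorem regDist_pos (p x : EuclideanSpace ℝ (Fin n)) : 0 < regDist p x :=
  Real.sqrt_pos.2 (by positivity)

theorem continuous_regDist (p : EuclideanSpace ℝ (Fin n)) : Continuous (regDist p) := by
  unfold regDist; fun_prop

theorem norm_sub_le_regDist (p x : EuclideanSpace ℝ (Fin n)) : ‖x - p‖ ≤ regDist p x :=
  Real.le_sqrt_of_sq_le (by linarith)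

theorem hasLineDerivAt_regDist (p x : EuclideanSpace ℝ (Fin n)) (i : Fin n) :
    HasLineDerivAt ℝ (regDist p) ((x i - p i) / regDist p x) x (EuclideanSpace.single i (1 : ℝ)) := by
  have h1 := ((((hasFDerivAt_id x).sub_const p).norm_sq).const_add 1).sqrt
    (by simp only [id]; positivity)
  have h2 := h1.hasLineDerivAt (EuclideanSpace.single i (1 : ℝ))
  refine HasDerivAt.congr_deriv h2 ?_
  simp [regDist, EuclideanSpace.inner_single_right]
  field_simp

/-- The spatial gradient of the regularized distance has length at most 1, so the level sets of the
energy weight are space-like. The 1 under the root avoids the singularity of |x - p| at p. -/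
theorem sum_sq_regDist_le (p x : EuclideanSpace ℝ (Fin n)) :
    ∑ i, ((x i - p i) / regDist p x) ^ 2 ≤ 1 := by
  simp only [div_pow, ← Finset.sum_div]
  have : ∑ i, (x i - p i) ^ 2 = ‖x - p‖ ^ 2 := by
    rw [EuclideanSpace.norm_sq_eq]; simp
  rw [this]
  refine (div_le_one (pow_pos (regDist_pos p x) 2)).2 ?_
  exact pow_le_pow_left₀ (norm_nonneg _) (norm_sub_le_regDist p x) 2

/-- The positive part of `T - t - √(1 + |x - p|²)`; its square is the energy weight. -/
def coneHeight (p : EuclideanSpace ℝ (Fin n)) (T : ℝ) (z : EuclideanSpace ℝ (Fin n) × ℝ) : ℝ :=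
  max (T - z.2 - regDist p z.1) 0

theorem continuous_coneHeight (p : EuclideanSpace ℝ (Fin n)) (T : ℝ) :
    Continuous (coneHeight p T) :=
  ((continuous_const.sub continuous_snd).sub ((continuous_regDist p).comp continuous_fst)).max
    continuous_const

/-- Squaring the positive part removes its corner, so the weight is differentiable across the
boundary of its support. -/
theorem hasLineDerivAt_coneHeight_sq {p : EuclideanSpace ℝ (Fin n)} {T : ℝ}
    {z v : EuclideanSpace ℝ (Fin n) × ℝ} {d : ℝ}
    (h : HasLineDerivAt ℝ (fun z => T - z.2 - regDist p z.1) d z v) :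
    HasLineDerivAt ℝ (fun z => coneHeight p T z ^ 2) (2 * coneHeight p T z * d) z v := by
  have h1 := hasDerivAt_max_zero_pow 0 (T - z.2 - regDist p z.1)
  have h0 : (fun s : ℝ => (fun z : EuclideanSpace ℝ (Fin n) × ℝ => T - z.2 - regDist p z.1)
      (z + s • v)) 0 = T - z.2 - regDist p z.1 := by simp
  rw [← h0] at h1
  have h2 := h1.comp (0 : ℝ) h
  refine HasDerivAt.congr_deriv h2 ?_
  simp [coneHeight]

theorem hasLineDerivAt_coneHeight_sq_time (p : EuclideanSpace ℝ (Fin n)) (T : ℝ)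
    (z : EuclideanSpace ℝ (Fin n) × ℝ) :
    HasLineDerivAt ℝ (fun z => coneHeight p T z ^ 2) (-(2 * coneHeight p T z)) z (0, 1) := by
  have h : HasLineDerivAt ℝ (fun z : EuclideanSpace ℝ (Fin n) × ℝ => T - z.2 - regDist p z.1)
      (-1) z (0, 1) := by
    have h1 : HasDerivAt (fun t => T - t - regDist p z.1) (-1) z.2 :=
      ((hasDerivAt_id z.2).const_sub T).sub_const _
    exact hasLineDerivAt_time h1
  have := hasLineDerivAt_coneHeight_sq h
  rwa [mul_neg_one] at this

theorem hasLineDerivAt_coneHeight_sq_space (p : EuclideanSpace ℝ (Fin n)) (T : ℝ)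
    (z : EuclideanSpace ℝ (Fin n) × ℝ) (i : Fin n) :
    HasLineDerivAt ℝ (fun z => coneHeight p T z ^ 2)
      (-(2 * coneHeight p T z * ((z.1 i - p i) / regDist p z.1))) z
      (EuclideanSpace.single i (1 : ℝ), 0) := by
  have h : HasLineDerivAt ℝ (fun z : EuclideanSpace ℝ (Fin n) × ℝ => T - z.2 - regDist p z.1)
      (-((z.1 i - p i) / regDist p z.1)) z (EuclideanSpace.single i (1 : ℝ), 0) := by
    have h1 := HasDerivAt.const_sub (T - z.2) (hasLineDerivAt_regDist p z.1 i)
    refine HasDerivAt.congr_of_eventuallyEq h1 (Eventually.of_forall fun s => ?_)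
    simp
  have := hasLineDerivAt_coneHeight_sq h
  rwa [mul_neg] at this

/-- With s = Σ r_i b_i, Cauchy–Schwarz gives s² ≤ Σ b_i², so the expression is at least (A - s)². -/
theorem energy_density_nonneg {ι : Type*} (s : Finset ι) (A : ℝ) (b r : ι → ℝ)
    (hr : ∑ i ∈ s, r i ^ 2 ≤ 1) :
    0 ≤ A ^ 2 + ∑ i ∈ s, b i ^ 2 - 2 * A * ∑ i ∈ s, r i * b i := by
  have h1 := Finset.sum_mul_sq_le_sq_mul_sq s r b
  have h2 : 0 ≤ ∑ i ∈ s, b i ^ 2 := Finset.sum_nonneg fun i _ => sq_nonneg _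
  have h3 : (∑ i ∈ s, r i * b i) ^ 2 ≤ ∑ i ∈ s, b i ^ 2 :=
    h1.trans (mul_le_of_le_one_left h2 hr)
  nlinarith [sq_nonneg (A - ∑ i ∈ s, r i * b i)]

/-- Energy estimate: the time derivative of a mollified weak solution vanishing near `t = 0` is
zero. -/
theorem moll_timePrimitive_lap_eq_zero (hn : 1 ≤ n) {q : EuclideanSpace ℝ (Fin n) × ℝ → ℝ}
    {φ : EuclideanSpace ℝ (Fin n) → ℝ} (hq : Continuous q) (hφc : Continuous φ)
    (hφ : ∀ x, 0 < φ x) (hq0 : ∀ x t, t ≤ φ x → q (x, t) = 0)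
    (hweak : ∀ v, IsTest v → ∫ z, z.2 ^ (n - 1) * q z * epd v z = 0)
    {ψ : EuclideanSpace ℝ (Fin n) → ℝ} (hψ : IsBump ψ) (p : EuclideanSpace ℝ (Fin n)) (t₀ : ℝ) :
    (t₀ ^ (n - 1))⁻¹ * moll (timePrimitive q) (lap ψ) (p, t₀) = 0 := by
  have hvol : (volume : Measure (EuclideanSpace ℝ (Fin n) × ℝ)).IsAddHaarMeasure := by
    rw [Measure.volume_eq_prod]; infer_instance
  have hQc := continuous_timePrimitive hq
  have hQ0 := timePrimitive_eq_zero hφ hq0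
  let e : Fin n → EuclideanSpace ℝ (Fin n) := fun i => EuclideanSpace.single i 1
  let P := moll (timePrimitive q) (lap ψ)
  let H := moll q (lap ψ)
  -- For w = `moll q ψ`, these are A = w_t, b = ∇w, c = ∇w_t, d_i = ∂_i² w, and H = Δw.
  let A : EuclideanSpace ℝ (Fin n) × ℝ → ℝ := fun z => (z.2 ^ (n - 1))⁻¹ * P z
  let b : Fin n → EuclideanSpace ℝ (Fin n) × ℝ → ℝ := fun i => moll q (dirD (e i) ψ)
  let c : Fin n → EuclideanSpace ℝ (Fin n) × ℝ → ℝ := fun i z =>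
    (z.2 ^ (n - 1))⁻¹ * moll (timePrimitive q) (dirD (e i) (lap ψ)) z
  let d : Fin n → EuclideanSpace ℝ (Fin n) × ℝ → ℝ := fun i =>
    moll q (dirD (e i) (dirD (e i) ψ))
  let r : Fin n → EuclideanSpace ℝ (Fin n) × ℝ → ℝ := fun i z => (z.1 i - p i) / regDist p z.1
  -- At (p, t₀) the regularized distance is 1, so this choice makes the weight function `m` equal to
  -- 1 there.
  let T : ℝ := t₀ + 2
  let m := coneHeight p T
  have hm0 : ∀ z, 0 ≤ m z := fun z => le_max_right _ _
  have contq : ∀ {η}, IsBump η → Continuous (moll q η) := fun h =>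
    continuous_moll hq h.contDiff.continuous h.compact
  have contQ : ∀ {η}, IsBump η → Continuous (moll (timePrimitive q) η) := fun h =>
    continuous_moll hQc h.contDiff.continuous h.compact
  have posQ : ∀ {η}, IsBump η → ∀ z ∈ tsupport (moll (timePrimitive q) η), 0 < z.2 := fun h =>
    tsupport_moll_pos hφc hφ hQ0 h.compact
  have hPz : ∀ z, z.2 ≤ 0 → P z = 0 := fun z hz =>
    image_eq_zero_of_notMem_tsupport fun h => absurd (posQ hψ.lap z h) (not_lt.2 hz)
  have hAz : ∀ z, z.2 ≤ 0 → A z = 0 := fun z hz => by simp only [A]; rw [hPz z hz, mul_zero]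
  have hbz : ∀ i z, z.2 ≤ 0 → b i z = 0 := fun i z hz =>
    image_eq_zero_of_notMem_tsupport fun h =>
      absurd (tsupport_moll_pos hφc hφ hq0 (hψ.dirD (e i)).compact z h) (not_lt.2 hz)
  have hAc : Continuous A := continuous_inv_pow_mul (n - 1) (contQ hψ.lap) (posQ hψ.lap)
  have hApos : ∀ z ∈ tsupport A, 0 < z.2 := by
    intro z hz
    refine posQ hψ.lap z (closure_mono (fun w hw => ?_) hz)
    exact right_ne_zero_of_mul hw
  have hAtc : Continuous fun z => A z / z.2 := continuous_div_time hAc hApos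
  have hbc : ∀ i, Continuous (b i) := fun i => contq (hψ.dirD _)
  have hcc : ∀ i, Continuous (c i) := fun i =>
    continuous_inv_pow_mul (n - 1) (contQ (hψ.lap.dirD _)) (posQ (hψ.lap.dirD _))
  have hdc : ∀ i, Continuous (d i) := fun i => contq ((hψ.dirD _).dirD _)
  have hHc : Continuous H := contq hψ.lap
  have hmc : Continuous m := continuous_coneHeight p T
  have hrc : ∀ i, Continuous (r i) := fun i =>
    Continuous.div (by fun_prop) ((continuous_regDist p).comp continuous_fst)
      fun z => (regDist_pos p z.1).ne'
  have hsumd : ∀ z, ∑ i, d i z = H z := fun z =>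
    (moll_sum Finset.univ hq (fun i _ => ((hψ.dirD _).dirD _).contDiff.continuous)
      (fun i _ => ((hψ.dirD _).dirD _).compact) z).symm
  have one_le : (1 : WithTop ℕ∞) ≤ 2 := by norm_num
  have dA_space : ∀ i z, HasLineDerivAt ℝ A (c i z) z (e i, 0) := by
    intro i z
    have h1 := hasLineDerivAt_moll_space hQc (hψ.lap.contDiff_of_le_two one_le)
      hψ.lap.compact (e i) z
    have h2 := HasDerivAt.const_mul ((z.2 ^ (n - 1))⁻¹) h1
    refine HasDerivAt.congr_of_eventuallyEq h2 (Eventually.of_forall fun s => ?_)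
    simp [A, P]
  have db_space : ∀ i z, HasLineDerivAt ℝ (b i) (d i z) z (e i, 0) := fun i z =>
    hasLineDerivAt_moll_space hq ((hψ.dirD _).contDiff_of_le_two one_le) (hψ.dirD _).compact (e i) z
  have db_time : ∀ i z, HasLineDerivAt ℝ (b i) (c i z) z (0, 1) := by
    intro i z
    have := hasDerivAt_moll_time_of_weak hn hq hφc hφ hq0 hweak (hψ.dirD (e i)) z.1 z.2
    rw [← hψ.dirD_lap] at this
    exact hasLineDerivAt_time this
  -- Differentiate A = t^(-(n-1)) P with P_t = t^(n-1) H; for t ≤ 0 everything vanishes near the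
  -- point.
  have dA_time : ∀ z, HasLineDerivAt ℝ A (H z - ((n - 1 : ℕ) : ℝ) * (A z / z.2)) z (0, 1) := by
    intro z
    refine hasLineDerivAt_time ?_
    by_cases hz : z.2 ≤ 0
    · have h0 : A =ᶠ[𝓝 z] 0 := notMem_tsupport_iff_eventuallyEq.1
        fun h => absurd (hApos z h) (not_lt.2 hz)
      have hct : ContinuousAt (fun t : ℝ => (z.1, t)) z.2 := by fun_prop
      have h1 : (fun t => A (z.1, t)) =ᶠ[𝓝 z.2] fun _ => 0 := hct.eventually h0
      have hH0 : H z = 0 := image_eq_zero_of_notMem_tsupport fun h =>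
        absurd (tsupport_moll_pos hφc hφ hq0 hψ.lap.compact z h) (not_lt.2 hz)
      rw [hH0, hAz z hz, zero_div, mul_zero, sub_zero]
      exact (hasDerivAt_const z.2 (0 : ℝ)).congr_of_eventuallyEq h1
    · have hz' : z.2 ≠ 0 := fun h => hz h.le
      have h1 := hasDerivAt_moll_time hQc (q' := fun z => z.2 ^ (n - 1) * q z) (by fun_prop)
        (hasDerivAt_timePrimitive hq) hψ.lap.contDiff.continuous hψ.lap.compact z.1 z.2
      have h2 : moll (fun z => z.2 ^ (n - 1) * q z) (lap ψ) (z.1, z.2) = z.2 ^ (n - 1) * H z := by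
        simp only [H, moll, mul_assoc]
        exact integral_const_mul _ _
      rw [h2] at h1
      have h3 := ((hasDerivAt_pow (n - 1) z.2).inv (pow_ne_zero _ hz')).mul h1
      refine h3.congr_deriv ?_
      simp only [A, P, Pi.inv_apply, Prod.mk.eta]
      rcases Nat.eq_zero_or_pos (n - 1) with h0 | h0
      · rw [h0]; simp
      · obtain ⟨M, hM⟩ : ∃ M, n - 1 = M + 1 := ⟨n - 1 - 1, by omega⟩
        rw [hM]
        simp only [Nat.add_sub_cancel]
        field_simp
        ring
  -- Weighted energy density and half the flux. Both have compact support, from the weight on one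
  -- side and vanishing for t ≤ 0 on the other.
  let Xt : EuclideanSpace ℝ (Fin n) × ℝ → ℝ := fun z => m z ^ 2 * (A z ^ 2 + ∑ i, b i z ^ 2)
  let X : Fin n → EuclideanSpace ℝ (Fin n) × ℝ → ℝ := fun i z => m z ^ 2 * (A z * b i z)
  let Gt : EuclideanSpace ℝ (Fin n) × ℝ → ℝ := fun z =>
    -(2 * m z) * (A z ^ 2 + ∑ i, b i z ^ 2) + m z ^ 2 *
      (2 * (A z * (H z - ((n - 1 : ℕ) : ℝ) * (A z / z.2))) + ∑ i, 2 * (b i z * c i z))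
  let G : Fin n → EuclideanSpace ℝ (Fin n) × ℝ → ℝ := fun i z =>
    -(2 * m z * r i z) * (A z * b i z) + m z ^ 2 * (c i z * b i z + A z * d i z)
  have hXt : ∀ z, HasLineDerivAt ℝ Xt (Gt z) z (0, 1) := by
    intro z
    have h1 : HasLineDerivAt ℝ (fun z => ∑ i, b i z ^ 2) (∑ i, 2 * (b i z * c i z)) z (0, 1) :=
      HasDerivAt.fun_sum fun i _ => (db_time i z).sq_real
    exact (hasLineDerivAt_coneHeight_sq_time p T z).mul_real
      (HasDerivAt.add (dA_time z).sq_real h1)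
  have hX : ∀ i z, HasLineDerivAt ℝ (X i) (G i z) z (e i, 0) := fun i z =>
    (hasLineDerivAt_coneHeight_sq_space p T z i).mul_real ((dA_space i z).mul_real (db_space i z))
  have hsupp : ∀ {F : EuclideanSpace ℝ (Fin n) × ℝ → ℝ},
      (∀ z, m z = 0 → F z = 0) → (∀ z, z.2 ≤ 0 → F z = 0) → HasCompactSupport F := by
    intro F h1 h2
    refine HasCompactSupport.intro ((isCompact_closedBall p T).prod
      (isCompact_Icc (a := 0) (b := T))) fun z hz => ?_
    by_contra hF
    have ht : 0 < z.2 := by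
      by_contra h; exact hF (h2 z (not_lt.1 h))
    have hmz : 0 < T - z.2 - regDist p z.1 := by
      by_contra h
      exact hF (h1 z (max_eq_right (not_lt.1 h)))
    have h3 := norm_sub_le_regDist p z.1
    have h4 := norm_nonneg (z.1 - p)
    refine hz ⟨?_, ht.le, ?_⟩
    · rw [mem_closedBall, dist_eq_norm]; linarith
    · linarith
  have hXtc : Continuous Xt := (hmc.pow 2).mul
    ((hAc.pow 2).add (continuous_finsetSum _ fun i _ => (hbc i).pow 2))
  have hXc : ∀ i, Continuous (X i) := fun i => (hmc.pow 2).mul (hAc.mul (hbc i))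
  have hGtc : Continuous Gt := ((continuous_const.mul hmc).neg.mul
    ((hAc.pow 2).add (continuous_finsetSum _ fun i _ => (hbc i).pow 2))).add ((hmc.pow 2).mul
      ((continuous_const.mul (hAc.mul (hHc.sub (continuous_const.mul hAtc)))).add
        (continuous_finsetSum _ fun i _ => continuous_const.mul ((hbc i).mul (hcc i)))))
  have hGc : ∀ i, Continuous (G i) := fun i =>
    (((continuous_const.mul hmc).mul (hrc i)).neg.mul (hAc.mul (hbc i))).add
      ((hmc.pow 2).mul (((hcc i).mul (hbc i)).add (hAc.mul (hdc i))))
  have hIt : ∫ z, Gt z = 0 := integral_eq_zero_of_hasLineDerivAt hXtc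
    (hsupp (fun z hz => by simp [Xt, hz]) fun z hz => by simp [Xt, hAz z hz, hbz _ z hz]) hGtc hXt
  have hI : ∀ i, ∫ z, G i z = 0 := fun i => integral_eq_zero_of_hasLineDerivAt (hXc i)
    (hsupp (fun z hz => by simp [X, hz]) fun z hz => by simp [X, hAz z hz]) (hGc i) (hX i)
  have hGts : HasCompactSupport Gt :=
    hsupp (fun z hz => by simp [Gt, hz]) fun z hz => by simp [Gt, hAz z hz, hbz _ z hz]
  have hGs : ∀ i, HasCompactSupport (G i) := fun i =>
    hsupp (fun z hz => by simp [G, hz]) fun z hz => by simp [G, hAz z hz, hbz _ z hz]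
  -- In -∂_t(energy) + 2 div(flux) the second-order terms cancel. What remains comes from
  -- differentiating the weight and from the friction term, and both contributions are nonnegative;
  -- as a divergence E integrates to zero.
  let E : EuclideanSpace ℝ (Fin n) × ℝ → ℝ := fun z => -Gt z + ∑ i, 2 * G i z
  have hE : ∀ z, E z = 2 * m z * (A z ^ 2 + ∑ i, b i z ^ 2 - 2 * A z * ∑ i, r i z * b i z)
      + 2 * ((n - 1 : ℕ) : ℝ) * m z ^ 2 * (A z * (A z / z.2)) := by
    intro z
    have h1 : ∑ i, 2 * G i z = -(4 * m z * A z) * ∑ i, r i z * b i z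
        + m z ^ 2 * ∑ i, 2 * (b i z * c i z) + 2 * m z ^ 2 * A z * H z := by
      rw [← hsumd z, Finset.mul_sum, Finset.mul_sum, Finset.mul_sum, ← Finset.sum_add_distrib,
        ← Finset.sum_add_distrib]
      refine Finset.sum_congr rfl fun i _ => ?_
      simp only [G]
      ring
    simp only [E]
    rw [h1]
    simp only [Gt]
    ring
  have hEint : ∫ z, E z = 0 := by
    have hi1 : Integrable (fun z => -Gt z) volume :=
      (hGtc.integrable_of_hasCompactSupport hGts).neg
    have hi2 : ∀ i, Integrable (fun z => 2 * G i z) volume := fun i =>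
      ((hGc i).integrable_of_hasCompactSupport (hGs i)).const_mul 2
    simp only [E]
    rw [integral_add hi1 (integrable_finsetSum _ fun i _ => hi2 i), integral_neg, hIt,
      integral_finsetSum _ fun i _ => hi2 i]
    simp [integral_const_mul, hI]
  have hterm : ∀ z, 0 ≤ A z * (A z / z.2) := by
    intro z
    rcases le_or_gt z.2 0 with h | h
    · simp [hAz z h]
    · rw [← mul_div_assoc]
      exact div_nonneg (mul_self_nonneg _) h.le
  have hnn : ∀ z, 0 ≤ E z := by
    intro z
    rw [hE]
    have h1 := energy_density_nonneg Finset.univ (A z) (fun i => b i z) (fun i => r i z)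
      (sum_sq_regDist_le p z.1)
    have h2 := hm0 z
    have h3 := hterm z
    positivity
  have hEc : Continuous E := hGtc.neg.add
    (continuous_finsetSum _ fun i _ => continuous_const.mul (hGc i))
  have hEs : HasCompactSupport E :=
    hsupp (fun z hz => by simp [hE, hz]) fun z hz => by simp [hE, hAz z hz, hbz _ z hz]
  by_contra hne
  have hA : A (p, t₀) ≠ 0 := hne
  refine (hEc.integral_pos_of_hasCompactSupport_nonneg_nonzero (μ := volume) (x := (p, t₀)) hEs
    (fun z => hnn z) (ne_of_gt ?_)).ne' hEint
  rw [hE]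
  have hm1 : m (p, t₀) = 1 := by
    simp [m, coneHeight, regDist, T]
    norm_num
  have hr0 : ∀ i, r i (p, t₀) = 0 := fun i => by simp [r]
  simp only [hm1, hr0, zero_mul, Finset.sum_const_zero, mul_zero, sub_zero]
  have h1 : 0 < A (p, t₀) ^ 2 := by positivity
  have h2 : 0 ≤ ∑ i, b i (p, t₀) ^ 2 := Finset.sum_nonneg fun i _ => sq_nonneg _
  have h3 : 0 ≤ 2 * ((n - 1 : ℕ) : ℝ) * 1 ^ 2 * (A (p, t₀) * (A (p, t₀) / (p, t₀).2)) :=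
    mul_nonneg (by positivity) (hterm (p, t₀))
  nlinarith

/-- A continuous weak solution of the Euler–Poisson–Darboux equation which vanishes near `t = 0`
vanishes identically. -/
theorem eq_zero_of_weak (hn : 1 ≤ n) {q : EuclideanSpace ℝ (Fin n) × ℝ → ℝ}
    {φ : EuclideanSpace ℝ (Fin n) → ℝ} (hq : Continuous q) (hφc : Continuous φ)
    (hφ : ∀ x, 0 < φ x) (hq0 : ∀ x t, t ≤ φ x → q (x, t) = 0)
    (hweak : ∀ v, IsTest v → ∫ z, z.2 ^ (n - 1) * q z * epd v z = 0)
    (x : EuclideanSpace ℝ (Fin n)) (t : ℝ) : q (x, t) = 0 := by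
  have hmoll : ∀ ψ, IsBump ψ → ∀ p t, moll q ψ (p, t) = 0 := by
    intro ψ hψ p t
    have hd : ∀ t, HasDerivAt (fun t => moll q ψ (p, t)) 0 t := fun t => by
      have := hasDerivAt_moll_time_of_weak hn hq hφc hφ hq0 hweak hψ p t
      rwa [moll_timePrimitive_lap_eq_zero hn hq hφc hφ hq0 hweak hψ] at this
    have hconst : moll q ψ (p, t) = moll q ψ (p, 0) := is_const_of_deriv_eq_zero (fun t => (hd t).differentiableAt)
      (fun t => (hd t).deriv) t 0
    rw [hconst]
    exact moll_eq_zero hq0 fun y _ => (hφ y).le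
  have hct : Continuous fun y => q (y, t) := by fun_prop
  have hae := ae_eq_zero_of_integral_contDiff_smul_eq_zero (μ := volume) hct.locallyIntegrable
    fun g hg hgs => by
      -- The reflection turns the mollification at the origin into ∫ q(y, t) g(y) dy.
      have hb : IsBump fun y => g (-y) :=
        ⟨hg.comp contDiff_neg, hgs.comp_homeomorph (Homeomorph.neg _)⟩
      have := hmoll _ hb 0 t
      simp only [moll, zero_sub, neg_neg] at this
      simpa [mul_comm] using this
  have := (Continuous.ae_eq_iff_eq volume hct continuous_const).1 hae
  exact congrFun this x

end Uniqueness

end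

/-! ### The theorem. -/

theorem lemma4p2 (n : ℕ) (hn : 1 ≤ n)
    (f : EuclideanSpace ℝ (Fin n) → ℝ) (hf : Continuous f)
    (S : Set (EuclideanSpace ℝ (Fin n) × ℝ)) (hS : IsSpaceLike S)
    (hpos : ∀ z ∈ S, 0 < z.2)
    (hzero : ∀ z ∈ S, sphericalMeanTransform f z = 0)
    (hderiv : ∀ z ∈ S, HasFDerivAt (sphericalMeanTransform f)
      (0 : EuclideanSpace ℝ (Fin n) × ℝ →L[ℝ] ℝ) z)
    (p : EuclideanSpace ℝ (Fin n)) (T : ℝ) (habove : IsAbove S p T) :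
    sphericalMeanTransform f (p, T) = 0 := by
  obtain ⟨φ, hφ, hSφ⟩ := hS.exists_graph
  have hmem : ∀ x, (x, φ x) ∈ S := fun x => (hSφ x _).2 rfl
  have hφpos : ∀ x, 0 < φ x := fun x => hpos _ (hmem x)
  have hφc : Continuous φ := by
    refine (LipschitzWith.of_dist_le_mul (K := 2) fun x y => ?_).continuous
    rw [dist_eq_norm, dist_eq_norm]
    exact hφ x y
  have hT : φ p < T := by
    obtain ⟨⟨s, hs, hsS⟩, hray⟩ := habove
    rw [hSφ] at hsS
    -- The strict inequality holds because the ray contains its endpoint T.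
    refine lt_of_le_of_ne (hsS ▸ hs.2) fun h => hray T (Set.self_mem_Ici) ((hSφ p T).2 h.symm)
  have hu := continuous_sphMean hf
  have hu0 : ∀ x, sphMean f (x, φ x) = 0 := fun x => by
    rw [← sphericalMeanTransform_eq_sphMean hf (z := (x, φ x)) (hφpos x).le]
    exact hzero _ (hmem x)
  have hflat : ∀ x, sphMean f =o[nhds (x, φ x)] fun z => z - (x, φ x) := by
    intro x
    have h1 := (hderiv _ (hmem x)).isLittleO
    have h2 : ∀ᶠ z : EuclideanSpace ℝ (Fin n) × ℝ in nhds (x, φ x), 0 < z.2 :=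
      continuous_snd.continuousAt.eventually (lt_mem_nhds (hφpos x))
    refine h1.congr' ?_ Filter.EventuallyEq.rfl
    filter_upwards [h2] with z hz
    rw [hzero _ (hmem x), sphericalMeanTransform_eq_sphMean hf hz.le]
    simp
  -- The maximum implements the cutoff: above the graph q = u / t^(n-1), and below it q takes the
  -- value on the graph, which is 0. It also keeps the divisor positive, so q is continuous on all
  -- of ℝⁿ × ℝ.
  let q : EuclideanSpace ℝ (Fin n) × ℝ → ℝ := fun z =>
    (max z.2 (φ z.1) ^ (n - 1))⁻¹ * sphMean f (z.1, max z.2 (φ z.1))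
  have hmax : ∀ z : EuclideanSpace ℝ (Fin n) × ℝ, 0 < max z.2 (φ z.1) := fun z =>
    lt_max_of_lt_right (hφpos _)
  have hmc : Continuous fun z : EuclideanSpace ℝ (Fin n) × ℝ => max z.2 (φ z.1) :=
    continuous_snd.max (hφc.comp continuous_fst)
  have hq : Continuous q := ((hmc.pow _).inv₀ fun z => pow_ne_zero _ (hmax z).ne').mul
    (hu.comp (continuous_fst.prodMk hmc))
  have hq0 : ∀ x t, t ≤ φ x → q (x, t) = 0 := by
    intro x t ht
    simp only [q]
    rw [max_eq_right ht, hu0, mul_zero]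
  have hweak : ∀ v, IsTest v → ∫ z, z.2 ^ (n - 1) * q z * epd v z = 0 := by
    intro v hv
    rw [← epigraphPairing_eq_zero hu (fun v hv => integral_sphMean_mul_epd hn hf hv) hφ hφc hflat hv,
      epigraphPairing, ← integral_indicator (isOpen_epigraph hφc).measurableSet]
    congr 1
    funext z
    by_cases hz : φ z.1 < z.2
    · rw [Set.indicator_of_mem (by exact hz)]
      simp only [q]
      rw [max_eq_left hz.le, mul_inv_cancel_left₀ (pow_ne_zero _ ((hφpos _).trans hz).ne')]
    · rw [Set.indicator_of_notMem (by exact hz), hq0 z.1 z.2 (not_lt.1 hz)]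
      simp
  have hfin := eq_zero_of_weak hn hq hφc hφpos hq0 hweak p T
  have hT0 : 0 < T := (hφpos p).trans hT
  rw [sphericalMeanTransform_eq_sphMean hf (z := (p, T)) hT0.le]
  simp only [q] at hfin
  rw [max_eq_left hT.le] at hfin
  exact (mul_eq_zero.1 hfin).resolve_left (inv_ne_zero (pow_ne_zero _ hT0.ne'))
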